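/- Let $n\ge 1$ and $\theta>1/2$. Write $\hat f(\xi)=\int_{\mathbf R^n}e^{-ix\cdot\xi}f(x)\,dx$ for the Fourier transform (extended to $L^2(\mathbf R^n)$), and let $L_\theta$ be the operator on $L^2(\mathbf R^n)$ given by $\widehat{L_\theta f}(\xi)=\log(1+|\xi|^{2\theta})\hat f(\xi)$, with domain the set of $f\in L^2(\mathbf R^n)$ for which $\log(1+|\xi|^{2\theta})\hat f\in L^2(\mathbf R^n)$. For $u_1\in L^2(\mathbf R^n)$ consider the Cauchy problem $$u_{tt}-\Delta u+L_\theta u_t=0\quad\text{in }(0,\infty)\times\mathbf R^n,\qquad u(0,\cdot)=0,\quad u_t(0,\cdot)=u_1 .$$ A mild solution is a function $u\in C([0,\infty);H^1(\mathbf R^n))\cap C^1([0,\infty);L^2(\mathbf R^n))$ with $u(0)=0$ and $u_t(0)=u_1$ such that, for every $t\ge 0$, $\int_0^t u(s)\,ds\in H^2(\mathbf R^n)$ and $$u_t(t)-\Delta\int_0^t u(s)\,ds+L_\theta u(t)=u_1\quad\text{in }L^2(\mathbf R^n).$$ Theorem 1.3. There is a constant $C=C_{n,\theta}>0$, depending only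 on $n$ and $\theta$, such that the following holds. Let $u_1\in L^2(\mathbf R^n)\cap L^{1,1}(\mathbf R^n)$, i.e. $u_1\in L^2(\mathbf R^n)\cap L^1(\mathbf R^n)$ and $\|u_1\|_{1,1}:=\int_{\mathbf R^n}(1+|x|)|u_1(x)|\,dx<\infty$, and put $$P_1=\int_{\mathbf R^n}u_1(x)\,dx,\qquad I_0=\|u_1\|_{1,1}+\|u_1\|_{L^2}.$$ Then the problem has a unique mild solution $u$, and there is a $T>0$ (which may depend on $u_1$) such that for all $t\ge T$ $$C\,|P_1|\,t^{-\frac{n}{4\theta}}\le\|u_t(t,\cdot)\|_{L^2}+\|\nabla u(t,\cdot)\|_{L^2}\le C^{-1}I_0\,t^{-\frac{n}{4\theta}} .$$ -/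

import Mathlib

open MeasureTheory Set
open scoped FourierTransform SchwartzMap LineDeriv Laplacian

noncomputable section

/-- The Euclidean space `ℝⁿ`. -/
abbrev Rn (n : ℕ) : Type := EuclideanSpace ℝ (Fin n)

/-- The complex Hilbert space `L²(ℝⁿ)`. -/
abbrev L2 (n : ℕ) : Type := Lp (α := Rn n) ℂ 2 volume

/-- The weighted norm `‖f‖_{1,γ} = ∫ (1 + |x|^γ) |f(x)| dx`. -/
def weightedL1Norm {n : ℕ} (γ : ℝ) (f : Rn n → ℂ) : ℝ :=
  ∫ x, (1 + ‖x‖ ^ γ) * ‖f x‖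

/-- `f ∈ L^{1,γ}(ℝⁿ)`: `f` is integrable and `‖f‖_{1,γ}` is finite. -/
def MemWeightedL1 {n : ℕ} (γ : ℝ) (f : Rn n → ℂ) : Prop :=
  Integrable f ∧ Integrable (fun x => (1 + ‖x‖ ^ γ) * ‖f x‖)

/-- The symbol `log (1 + |ζ|^{2θ})` of the damping. Mathlib's Fourier transform is
`𝓕 f ξ = ∫ e^{-2πi x·ξ} f(x) dx`, that is, the transform `∫ e^{-i x·ζ} f(x) dx`
taken at the frequency `ζ = 2π ξ`. -/
def logSymbol {n : ℕ} (θ : ℝ) (ξ : Rn n) : ℂ :=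
  ((Real.log (1 + (2 * Real.pi * ‖ξ‖) ^ (2 * θ)) : ℝ) : ℂ)

/-- `f ∈ D(L_θ)`: the function `log (1 + |ζ|^{2θ}) f̂` is in `L²`. -/
def MemLogDomain {n : ℕ} (θ : ℝ) (f : L2 n) : Prop :=
  MemLp (fun ξ => logSymbol θ ξ * (𝓕 f : L2 n) ξ) 2 volume

/-- The logarithmic damping `L_θ f = 𝓕⁻¹ (log (1 + |ζ|^{2θ}) f̂)` for `f ∈ D(L_θ)`. -/
def logDamping {n : ℕ} (θ : ℝ) (f : L2 n) (hf : MemLogDomain θ f) : L2 n :=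
  𝓕⁻ (MemLp.toLp _ hf : L2 n)

open Classical in
/-- The weak partial derivative `∂f/∂xᵢ` of `f ∈ L²`, when it exists in `L²`: the `g ∈ L²` that
represents the distributional derivative (it is unique, since an element of `L²` is determined
by the distribution that it defines). The value is `0` if there is no such `g`. -/
def weakPartial {n : ℕ} (i : Fin n) (f : L2 n) : L2 n :=
  if h : ∃ g : L2 n, ∂_{EuclideanSpace.single i (1 : ℝ)} (f : 𝓢'(Rn n, ℂ)) = (g : 𝓢'(Rn n, ℂ))
  then h.choose else 0

/-- `‖∇f‖_{L²}` for `f ∈ H¹(ℝⁿ)`. -/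
def gradNorm {n : ℕ} (f : L2 n) : ℝ :=
  Real.sqrt (∑ i : Fin n, ‖weakPartial i f‖ ^ 2)

/-- The time derivative `u_t(t)` in `L²` of a curve on `[0, ∞)` (one-sided at `t = 0`). -/
def timeDeriv {n : ℕ} (u : ℝ → L2 n) (t : ℝ) : L2 n :=
  derivWithin u (Ici 0) t

/-- `u` is a mild solution, in `C([0,∞); H¹) ∩ C¹([0,∞); L²)`, of
`u_tt - Δu + L_θ u_t = 0`, `u(0) = 0`, `u_t(0) = u₁`.

As a first-order equation for `U = (u, u_t)` in `H¹ × L²` this reads `U' = 𝒜 U`, where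
`𝒜 (w, z) = (z, Δw - L_θ z)` has the domain `H² × H¹`, and a mild solution is a continuous `U`
with `∫₀ᵗ U ds` in the domain and `U(t) = U(0) + 𝒜 ∫₀ᵗ U ds` for all `t ≥ 0`. The first component
of this says that `u_t` is the derivative of `u`; with `∫₀ᵗ u_t ds = u(t)`, the second is the
last field below. -/
structure IsMildSolution {n : ℕ} (θ : ℝ) (u₁ : L2 n) (u : ℝ → L2 n) : Prop where
  /-- `u ∈ C¹([0,∞); L²)` -/
  contDiffOn : ContDiffOn ℝ 1 u (Ici 0)
  /-- `u(t) ∈ H¹` -/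
  memSobolev_one : ∀ t, 0 ≤ t → TemperedDistribution.MemSobolev 1 2 (u t : 𝓢'(Rn n, ℂ))
  /-- the gradient is continuous in `L²`; with the continuity in `L²`, this is `u ∈ C([0,∞); H¹)` -/
  continuousOn_weakPartial : ∀ i : Fin n, ContinuousOn (fun t => weakPartial i (u t)) (Ici 0)
  /-- the first initial condition -/
  init : u 0 = 0
  /-- the second initial condition -/
  init_deriv : timeDeriv u 0 = u₁
  /-- `∫₀ᵗ u ds ∈ H²` -/
  memSobolev_two : ∀ t, 0 ≤ t →
    TemperedDistribution.MemSobolev 2 2 ((∫ s in (0 : ℝ)..t, u s : L2 n) : 𝓢'(Rn n, ℂ))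
  /-- `u_t(t) - Δ ∫₀ᵗ u ds + L_θ u(t) = u₁` -/
  equation : ∀ t, 0 ≤ t → ∃ h : MemLogDomain θ (u t),
    (timeDeriv u t : 𝓢'(Rn n, ℂ)) - Δ ((∫ s in (0 : ℝ)..t, u s : L2 n) : 𝓢'(Rn n, ℂ))
      + (logDamping θ (u t) h : 𝓢'(Rn n, ℂ)) = (u₁ : 𝓢'(Rn n, ℂ))

end

/-! The Fourier transform decouples the problem into scalar oscillators `s'' + b s' + r² s = 0`,
`s(0) = 0`, `s'(0) = 1`, with `r = |ζ|` and `b = log (1 + r^{2θ})`. The energy `E = s'² + r² s²` of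
each has derivative `-2 b s'²`, so it stays between `e^{-2bt}` and `1`. By Plancherel, `‖u_t‖² +
‖∇u‖²` is the integral of `E` against `|û₁|²` (`energy_solution`).

Upper bound: since `θ > 1/2`, the ratio `b / r` is bounded (`damping_le`), and a modified energy
gives `E ≤ 2 e^{-κbt}` with `κ > 0` depending only on `θ` (`energy_le_exp`). For `r ≤ 1`, `b` is
comparable to `r^{2θ}` and `û₁` is bounded by the `L¹` norm, so rescaling `ζ` by `t^{1/(2θ)}`
produces `t^{-n/(2θ)}`. For `r ≥ 1`, `b ≥ 1/2` and the contribution is exponentially small.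

Lower bound: on the ball `r^{2θ} ≤ 1/t` the energy is at least `e^{-2}`, and for large `t` also
`|û₁| ≥ |P₁|/2` there, because `û₁` is continuous with value `P₁` at `0`. The volume of the ball
gives the same rate.

Existence: the oscillator bounds make `s`, `s'` and `∫ s` bounded multipliers, with enough decay in
`r` for the Sobolev conditions. Uniqueness: on bounded frequencies the difference of two solutions
obeys a linear equation with bounded coefficients, and Grönwall's inequality applies
(`eq_zero_of_evolution`). -/

namespace DampedWave

/-! ### The damped oscillator at one frequency -/

/-- The generator of the system `s' = v`, `v' = -r² s - b v`. -/
noncomputable def generator (b r : ℝ) : (ℝ × ℝ) →L[ℝ] (ℝ × ℝ) :=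
  (ContinuousLinearMap.inl ℝ ℝ ℝ).comp (ContinuousLinearMap.snd ℝ ℝ ℝ)
    - r ^ 2 • (ContinuousLinearMap.inr ℝ ℝ ℝ).comp (ContinuousLinearMap.fst ℝ ℝ ℝ)
    - b • (ContinuousLinearMap.inr ℝ ℝ ℝ).comp (ContinuousLinearMap.snd ℝ ℝ ℝ)

/-- The solution of `s' = v`, `v' = -r² s - b v` with `s(0) = 0`, `v(0) = 1`. -/
noncomputable def flow (b r t : ℝ) : ℝ × ℝ :=
  NormedSpace.exp (t • generator b r) (0, 1)

/-- The solution of `s'' + b s' + r² s = 0` with `s(0) = 0`, `s'(0) = 1`. -/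
noncomputable def disp (b r t : ℝ) : ℝ := (flow b r t).1

/-- The derivative of `disp`. -/
noncomputable def vel (b r t : ℝ) : ℝ := (flow b r t).2

/-- The primitive of `disp` that vanishes at `0`. -/
noncomputable def primDisp (b r t : ℝ) : ℝ := ∫ s in (0 : ℝ)..t, disp b r s

theorem generator_apply (b r : ℝ) (p : ℝ × ℝ) :
    generator b r p = (p.2, -r ^ 2 * p.1 - b * p.2) := by
  ext <;> simp [generator]

/-- The matrix exponential is jointly continuous in the coefficients, which avoids the case
distinction between real and complex characteristic roots. It supplies the measurability of all
multipliers in `ξ`. -/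
theorem continuous_flow {X : Type*} [TopologicalSpace X] {b r t : X → ℝ} (hb : Continuous b)
    (hr : Continuous r) (ht : Continuous t) : Continuous fun x => flow (b x) (r x) (t x) := by
  let _ : NormedAlgebra ℚ ((ℝ × ℝ) →L[ℝ] (ℝ × ℝ)) := NormedAlgebra.restrictScalars ℚ ℝ _
  have h : Continuous fun x => NormedSpace.exp (t x • generator (b x) (r x)) := by
    refine (NormedSpace.exp_continuous (𝔸 := (ℝ × ℝ) →L[ℝ] (ℝ × ℝ))).comp ?_
    unfold generator
    fun_prop
  exact h.clm_apply continuous_const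

theorem continuous_disp {X : Type*} [TopologicalSpace X] {b r t : X → ℝ} (hb : Continuous b)
    (hr : Continuous r) (ht : Continuous t) : Continuous fun x => disp (b x) (r x) (t x) :=
  (continuous_flow hb hr ht).fst

theorem continuous_vel {X : Type*} [TopologicalSpace X] {b r t : X → ℝ} (hb : Continuous b)
    (hr : Continuous r) (ht : Continuous t) : Continuous fun x => vel (b x) (r x) (t x) :=
  (continuous_flow hb hr ht).snd

theorem continuous_primDisp {X : Type*} [TopologicalSpace X] {b r : X → ℝ}
    (hb : Continuous b) (hr : Continuous r) (t : ℝ) :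
    Continuous fun x => primDisp (b x) (r x) t := by
  refine intervalIntegral.continuous_parametric_intervalIntegral_of_continuous' ?_ 0 t
  exact continuous_disp (hb.comp continuous_fst) (hr.comp continuous_fst) continuous_snd

variable (b r t : ℝ)

theorem hasDerivAt_flow : HasDerivAt (flow b r) (generator b r (flow b r t)) t := by
  have h := hasDerivAt_exp_smul_const' (𝕂 := ℝ) (generator b r) t
  have h2 := ((ContinuousLinearMap.apply ℝ (ℝ × ℝ) ((0, 1) : ℝ × ℝ)).hasFDerivAt).comp_hasDerivAt
    t h
  exact h2

theorem hasDerivAt_disp : HasDerivAt (disp b r) (vel b r t) t := by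
  have h := (hasDerivAt_flow b r t).hasFDerivAt.fst.hasDerivAt
  refine HasDerivAt.congr_deriv h ?_
  simp [generator_apply, vel]

theorem hasDerivAt_vel :
    HasDerivAt (vel b r) (-r ^ 2 * disp b r t - b * vel b r t) t := by
  have h := (hasDerivAt_flow b r t).hasFDerivAt.snd.hasDerivAt
  refine HasDerivAt.congr_deriv h ?_
  simp [generator_apply, vel, disp]

@[simp] theorem disp_zero : disp b r 0 = 0 := by simp [disp, flow]

@[simp] theorem vel_zero : vel b r 0 = 1 := by simp [vel, flow]

@[simp] theorem primDisp_zero : primDisp b r 0 = 0 := by simp [primDisp]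

theorem hasDerivAt_primDisp : HasDerivAt (primDisp b r) (disp b r t) t := by
  have hc : Continuous (disp b r) := continuous_disp continuous_const continuous_const continuous_id
  exact intervalIntegral.integral_hasDerivAt_right (hc.intervalIntegrable _ _)
    (hc.stronglyMeasurableAtFilter _ _) hc.continuousAt

/-- The oscillator equation integrated once in time. This is the mild equation at a single
frequency. -/
theorem sq_mul_primDisp : r ^ 2 * primDisp b r t = 1 - vel b r t - b * disp b r t := by
  have hd : ∀ s, HasDerivAt (fun s => r ^ 2 * primDisp b r s + vel b r s + b * disp b r s) 0 s := by
    intro s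
    have h := (((hasDerivAt_primDisp b r s).const_mul (r ^ 2)).add (hasDerivAt_vel b r s)).add
      ((hasDerivAt_disp b r s).const_mul b)
    refine HasDerivAt.congr_deriv h ?_
    ring
  have h := is_const_of_deriv_eq_zero (fun s => (hd s).differentiableAt) (fun s => (hd s).deriv) t 0
  simp at h
  linarith

/-- The pointwise energy. -/
noncomputable def energy : ℝ := vel b r t ^ 2 + r ^ 2 * disp b r t ^ 2

theorem energy_nonneg : 0 ≤ energy b r t := by unfold energy; positivity

theorem hasDerivAt_energy : HasDerivAt (energy b r) (-2 * b * vel b r t ^ 2) t := by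
  have h := ((hasDerivAt_vel b r t).pow 2).add (((hasDerivAt_disp b r t).pow 2).const_mul (r ^ 2))
  refine HasDerivAt.congr_deriv h ?_
  simp
  ring

variable {b r t}

theorem energy_le_one (hb : 0 ≤ b) (ht : 0 ≤ t) : energy b r t ≤ 1 := by
  have h : Antitone (energy b r) := antitone_of_hasDerivAt_nonpos (hasDerivAt_energy b r)
    (fun s => by have := mul_nonneg hb (sq_nonneg (vel b r s)); simp only [Pi.zero_apply]; nlinarith)
  simpa [energy] using h ht

/-- The dissipation `2 b v²` is at most `2 b E`, so `E e^{2bt}` is nondecreasing and starts from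
`1`. -/
theorem exp_le_energy (hb : 0 ≤ b) (ht : 0 ≤ t) : Real.exp (-2 * b * t) ≤ energy b r t := by
  have hd : ∀ s, HasDerivAt (fun s => energy b r s * Real.exp (2 * b * s))
      (2 * b * (r ^ 2 * disp b r s ^ 2) * Real.exp (2 * b * s)) s := by
    intro s
    have h := (hasDerivAt_energy b r s).mul (((hasDerivAt_id s).const_mul (2 * b)).exp)
    refine HasDerivAt.congr_deriv h ?_
    simp [energy]
    ring
  have h : Monotone fun s => energy b r s * Real.exp (2 * b * s) :=
    monotone_of_hasDerivAt_nonneg hd (fun s => by positivity)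
  have h1 := h ht
  simp [energy] at h1
  have h2 : Real.exp (-2 * b * t) * Real.exp (2 * b * t) = 1 := by
    rw [← Real.exp_add]; simp
  have h3 := Real.exp_pos (2 * b * t)
  unfold energy
  nlinarith

theorem abs_vel_le_one (hb : 0 ≤ b) (ht : 0 ≤ t) : |vel b r t| ≤ 1 := by
  have h := energy_le_one (r := r) hb ht
  rw [abs_le_one_iff_mul_self_le_one]
  unfold energy at h
  nlinarith [sq_nonneg (r * disp b r t)]

theorem mul_abs_disp_le_one (hb : 0 ≤ b) (hr : 0 ≤ r) (ht : 0 ≤ t) : r * |disp b r t| ≤ 1 := by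
  have h := energy_le_one (r := r) hb ht
  unfold energy at h
  have h2 : r * |disp b r t| = |r * disp b r t| := by rw [abs_mul, abs_of_nonneg hr]
  rw [h2, abs_le_one_iff_mul_self_le_one]
  nlinarith [sq_nonneg (vel b r t)]

/-- The velocity is at most `1` in absolute value. The Lipschitz constant does not depend on the
frequency, as dominated convergence of difference quotients requires. -/
theorem abs_disp_sub_le {s : ℝ} (hb : 0 ≤ b) (hs : 0 ≤ s) (ht : 0 ≤ t) :
    |disp b r s - disp b r t| ≤ |s - t| := by
  have h := (convex_Ici (0 : ℝ)).norm_image_sub_le_of_norm_hasDerivWithin_le (C := 1)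
    (fun x _ => (hasDerivAt_disp b r x).hasDerivWithinAt)
    (fun x hx => abs_vel_le_one (r := r) hb hx) ht hs
  simpa using h

theorem abs_disp_le (hb : 0 ≤ b) (ht : 0 ≤ t) : |disp b r t| ≤ t := by
  simpa [abs_of_nonneg ht] using abs_disp_sub_le (r := r) hb ht le_rfl

theorem abs_primDisp_sub_le {s T : ℝ} (hb : 0 ≤ b) (hs : s ∈ Icc 0 T) (ht : t ∈ Icc 0 T) :
    |primDisp b r s - primDisp b r t| ≤ T * |s - t| :=
  (convex_Icc (0 : ℝ) T).norm_image_sub_le_of_norm_hasDerivWithin_le (C := T)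
    (fun x _ => (hasDerivAt_primDisp b r x).hasDerivWithinAt)
    (fun _ hx => (abs_disp_le (r := r) hb hx.1).trans hx.2) ht hs

theorem abs_primDisp_le (hb : 0 ≤ b) (ht : 0 ≤ t) : |primDisp b r t| ≤ t * t := by
  simpa [abs_of_nonneg ht] using
    abs_primDisp_sub_le (r := r) (s := t) (t := 0) (T := t) hb ⟨ht, le_rfl⟩ ⟨le_rfl, ht⟩

/-- In `sq_mul_primDisp` the right side is bounded, since `b |s| ≤ M r |s| ≤ M`. This is the source
of the `H²` regularity of the time integral. -/
theorem sq_mul_abs_primDisp_le {M : ℝ} (hb : 0 ≤ b) (hr : 0 ≤ r) (hM : b ≤ M * r) (hM0 : 0 ≤ M)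
    (ht : 0 ≤ t) : r ^ 2 * |primDisp b r t| ≤ 2 + M := by
  have h : r ^ 2 * |primDisp b r t| = |1 - vel b r t - b * disp b r t| := by
    rw [← sq_mul_primDisp, abs_mul, abs_of_nonneg (sq_nonneg r)]
  rw [h]
  have h1 := abs_vel_le_one (r := r) hb ht
  have h2 := mul_abs_disp_le_one (r := r) hb hr ht
  have h3 : |b * disp b r t| ≤ M := by
    rw [abs_mul, abs_of_nonneg hb]
    nlinarith [abs_nonneg (disp b r t)]
  rw [abs_le] at h1 h3 ⊢
  constructor <;> linarith

/-- Exponential decay of the energy, uniform in the frequency, when the damping is controlled by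
the frequency. -/
theorem energy_le_exp {M : ℝ} (hb : 0 ≤ b) (hr : 0 ≤ r) (hM : b ≤ M * r)
    (ht : 0 ≤ t) : energy b r t ≤ 2 * Real.exp (-((1 + M ^ 2)⁻¹ / 4) * b * t) := by
  -- This `κ` serves twice: `κ M ≤ 1/2` keeps the modified energy within a factor `2` of `E`, and `κ
  -- (1 + M²) = 1` lets the dissipation absorb the velocity terms of the correction.
  set κ := (1 + M ^ 2)⁻¹ with hκ
  have hκ0 : 0 < κ := by positivity
  have hκ1 : κ + κ * M ^ 2 = 1 := by rw [hκ]; field_simp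
  have hκM : κ * M ≤ 1 / 2 := by nlinarith [sq_nonneg (M - 1)]
  -- `E' = -2 b v²` shows no loss in the displacement. The derivative of the cross term contributes
  -- the missing `-κ b r² s²`.
  let F : ℝ → ℝ := fun s => energy b r s + κ * b * (vel b r s * disp b r s)
  -- The bound `b ≤ M r` enters here: it trades `b |s|` for `M r |s|`, which the energy controls.
  have hcross : ∀ s, b * |vel b r s * disp b r s| ≤ M * (|vel b r s| * (r * |disp b r s|)) := by
    intro s
    rw [abs_mul]
    have := mul_nonneg (abs_nonneg (vel b r s)) (abs_nonneg (disp b r s))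
    nlinarith
  have hE : ∀ s, energy b r s = |vel b r s| ^ 2 + (r * |disp b r s|) ^ 2 := by
    intro s; rw [mul_pow, sq_abs, sq_abs]; rfl
  have habs : ∀ s, |κ * b * (vel b r s * disp b r s)| ≤ energy b r s / 2 := by
    intro s
    rw [abs_mul, abs_of_nonneg (by positivity : 0 ≤ κ * b), hE]
    have h1 := hcross s
    set v := |vel b r s|
    set d := r * |disp b r s|
    have hv : 0 ≤ v := abs_nonneg _
    have hd : 0 ≤ d := by positivity
    calc κ * b * |vel b r s * disp b r s| = κ * (b * |vel b r s * disp b r s|) := by ring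
      _ ≤ κ * (M * (v * d)) := by gcongr
      _ = (κ * M) * (v * d) := by ring
      _ ≤ 1 / 2 * (v * d) := by gcongr
      _ ≤ _ := by nlinarith [sq_nonneg (v - d)]
  have hlow : ∀ s, energy b r s ≤ 2 * F s := by
    intro s
    have := (abs_le.1 (habs s)).1
    simp only [F]; linarith
  have hup : ∀ s, F s ≤ 2 * energy b r s := by
    intro s
    have := (abs_le.1 (habs s)).2
    have := energy_nonneg b r s
    simp only [F]; linarith
  have hF : ∀ s, HasDerivAt F (-2 * b * vel b r s ^ 2 + κ * b * (vel b r s ^ 2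
      - b * (vel b r s * disp b r s) - r ^ 2 * disp b r s ^ 2)) s := by
    intro s
    have h := (hasDerivAt_energy b r s).add
      (((hasDerivAt_vel b r s).mul (hasDerivAt_disp b r s)).const_mul (κ * b))
    refine HasDerivAt.congr_deriv h ?_
    ring
  have hF' : ∀ s, -2 * b * vel b r s ^ 2 + κ * b * (vel b r s ^ 2
      - b * (vel b r s * disp b r s) - r ^ 2 * disp b r s ^ 2) ≤ -(κ / 4) * b * F s := by
    intro s
    have h1 : -(b * (vel b r s * disp b r s)) ≤ M * (|vel b r s| * (r * |disp b r s|)) := by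
      refine le_trans ?_ (hcross s)
      rw [← abs_of_nonneg hb, ← abs_mul, abs_of_nonneg hb]
      exact neg_le_abs _
    have h2 := hup s
    rw [hE] at h2
    have h3 : vel b r s ^ 2 = |vel b r s| ^ 2 := (sq_abs _).symm
    have h4 : r ^ 2 * disp b r s ^ 2 = (r * |disp b r s|) ^ 2 := by rw [mul_pow, sq_abs]
    rw [h3, h4]
    set v := |vel b r s|
    set d := r * |disp b r s|
    have h5 : M * (v * d) ≤ d ^ 2 / 2 + M ^ 2 * v ^ 2 / 2 := by nlinarith [sq_nonneg (d - M * v)]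
    have h6 : -2 * v ^ 2 + κ * (v ^ 2 - b * (vel b r s * disp b r s) - d ^ 2)
        ≤ -(κ / 4) * F s := by
      have h7 : κ * (v ^ 2 - b * (vel b r s * disp b r s) - d ^ 2) ≤
          κ * (v ^ 2 + M ^ 2 * v ^ 2 / 2 - d ^ 2 / 2) := by
        exact mul_le_mul_of_nonneg_left (by linarith) hκ0.le
      have h8 : κ * F s ≤ κ * (2 * (v ^ 2 + d ^ 2)) := by gcongr
      have h9 : κ * v ^ 2 + κ * M ^ 2 * v ^ 2 = v ^ 2 := by rw [← add_mul, hκ1, one_mul]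
      have h10 : 0 ≤ κ * M ^ 2 * v ^ 2 := by positivity
      nlinarith [sq_nonneg v]
    calc _ = b * (-2 * v ^ 2 + κ * (v ^ 2 - b * (vel b r s * disp b r s) - d ^ 2)) := by ring
      _ ≤ b * (-(κ / 4) * F s) := by gcongr
      _ = _ := by ring
  have hanti : Antitone fun s => F s * Real.exp (κ / 4 * b * s) := by
    refine antitone_of_hasDerivAt_nonpos (fun s =>
      (hF s).mul (((hasDerivAt_id s).const_mul (κ / 4 * b)).exp)) (fun s => ?_)
    have h1 := hF' s
    have h2 := Real.exp_pos (κ / 4 * b * s)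
    simp only [id, mul_one]
    calc _ = (-2 * b * vel b r s ^ 2 + κ * b * (vel b r s ^ 2
      - b * (vel b r s * disp b r s) - r ^ 2 * disp b r s ^ 2) - -(κ / 4) * b * F s)
        * Real.exp (κ / 4 * b * s) := by ring
      _ ≤ 0 := mul_nonpos_of_nonpos_of_nonneg (by linarith) h2.le
  have h0 := hanti ht
  have hF0 : F 0 = 1 := by simp [F, energy]
  simp only [hF0, mul_zero, Real.exp_zero, mul_one] at h0
  have h2 : Real.exp (-(κ / 4) * b * t) * Real.exp (κ / 4 * b * t) = 1 := by
    rw [← Real.exp_add]; ring_nf; simp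
  have h3 := Real.exp_pos (κ / 4 * b * t)
  have h4 : F t ≤ Real.exp (-(κ / 4) * b * t) := by nlinarith
  linarith [hlow t]

end DampedWave

/-! ### Bounded multipliers on `L²` -/

namespace DampedWave

variable {n : ℕ}

open Classical in
/-- The product `m g` in `L²`, with the value `0` if it is not in `L²`. -/
noncomputable def mulL2 (m : Rn n → ℂ) (g : L2 n) : L2 n :=
  if h : MemLp (fun x => m x * g x) 2 volume then h.toLp else 0

theorem coeFn_mulL2 {m : Rn n → ℂ} {g : L2 n} (h : MemLp (fun x => m x * g x) 2 volume) :
    mulL2 m g =ᵐ[volume] fun x => m x * g x := by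
  rw [mulL2, dif_pos h]
  exact h.coeFn_toLp

theorem memLp_mul_of_bound {m : Rn n → ℂ} {K : ℝ} (hm : AEStronglyMeasurable m volume)
    (hK : ∀ x, ‖m x‖ ≤ K) (g : L2 n) : MemLp (fun x => m x * g x) 2 volume :=
  MemLp.of_le_mul (c := K) (Lp.memLp g) (hm.mul (Lp.aestronglyMeasurable g))
    (.of_forall fun x => by rw [norm_mul]; gcongr; exact hK x)

theorem norm_sq_eq_integral (f : L2 n) : ‖f‖ ^ 2 = ∫ x, ‖f x‖ ^ 2 := by
  have h := inner_self_eq_norm_sq_to_K (𝕜 := ℂ) f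
  rw [MeasureTheory.L2.inner_def] at h
  simp only [inner_self_eq_norm_sq_to_K] at h
  norm_cast at h
  exact h.symm

theorem integrable_norm_sq (f : L2 n) : Integrable fun x => ‖f x‖ ^ 2 :=
  (memLp_two_iff_integrable_sq_norm (Lp.aestronglyMeasurable f)).1 (Lp.memLp f)

theorem norm_sq_mulL2 {m : Rn n → ℂ} {g : L2 n} (h : MemLp (fun x => m x * g x) 2 volume) :
    ‖mulL2 m g‖ ^ 2 = ∫ x, ‖m x‖ ^ 2 * ‖g x‖ ^ 2 := by
  rw [norm_sq_eq_integral]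
  refine integral_congr_ae ?_
  filter_upwards [coeFn_mulL2 h] with x hx
  rw [hx, norm_mul, mul_pow]

/-- Dominated convergence for bounded multipliers acting on `L²`. -/
theorem tendsto_mulL2 {ι : Type*} {l : Filter ι} [l.IsCountablyGenerated] {m : ι → Rn n → ℂ}
    {m₀ : Rn n → ℂ} {K : ℝ} (g : L2 n) (hm : ∀ i, AEStronglyMeasurable (m i) volume)
    (hm₀ : AEStronglyMeasurable m₀ volume) (hK : ∀ᶠ i in l, ∀ x, ‖m i x‖ ≤ K)
    (hK₀ : ∀ x, ‖m₀ x‖ ≤ K)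
    (hlim : ∀ x, Filter.Tendsto (fun i => m i x) l (nhds (m₀ x))) :
    Filter.Tendsto (fun i => mulL2 (m i) g) l (nhds (mulL2 m₀ g)) := by
  rw [tendsto_iff_norm_sub_tendsto_zero]
  have hsq : Filter.Tendsto (fun i => ∫ x, ‖m i x - m₀ x‖ ^ 2 * ‖g x‖ ^ 2) l
      (nhds (∫ _ : Rn n, (0 : ℝ))) := by
    refine tendsto_integral_filter_of_dominated_convergence
      (fun x => (2 * K) ^ 2 * ‖g x‖ ^ 2) ?_ ?_ ((integrable_norm_sq g).const_mul _) ?_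
    · refine .of_forall fun i => ?_
      exact (((hm i).sub hm₀).norm.pow 2).mul ((Lp.aestronglyMeasurable g).norm.pow 2)
    · filter_upwards [hK] with i hi
      refine .of_forall fun x => ?_
      rw [Real.norm_of_nonneg (by positivity)]
      gcongr
      calc _ ≤ ‖m i x‖ + ‖m₀ x‖ := norm_sub_le _ _
        _ ≤ _ := by linarith [hi x, hK₀ x]
    · refine .of_forall fun x => ?_
      have h := ((((hlim x).sub_const (m₀ x)).norm).pow 2).mul_const (‖g x‖ ^ 2)
      simpa using h
  rw [integral_zero] at hsq
  have hsqrt := hsq.sqrt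
  rw [Real.sqrt_zero] at hsqrt
  refine hsqrt.congr' ?_
  filter_upwards [hK] with i hi
  rw [← Real.sqrt_sq (norm_nonneg (mulL2 (m i) g - mulL2 m₀ g)), norm_sq_eq_integral]
  congr 1
  refine integral_congr_ae ?_
  filter_upwards [Lp.coeFn_sub (mulL2 (m i) g) (mulL2 m₀ g),
    coeFn_mulL2 (memLp_mul_of_bound (hm i) hi g),
    coeFn_mulL2 (memLp_mul_of_bound hm₀ hK₀ g)] with x h1 h2 h3
  rw [h1, Pi.sub_apply, h2, h3, ← sub_mul, norm_mul, mul_pow]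

/-- Differentiation of a bounded family of multipliers in the parameter. -/
theorem hasDerivWithinAt_mulL2 {s : Set ℝ} {t : ℝ} {m : ℝ → Rn n → ℂ} {m' : Rn n → ℂ} {K : ℝ}
    (g : L2 n) (hm : ∀ τ, AEStronglyMeasurable (m τ) volume)
    (hb : ∀ τ ∈ s, ∃ B, ∀ x, ‖m τ x‖ ≤ B) (ht : t ∈ s)
    (hm' : AEStronglyMeasurable m' volume) (hK' : ∀ x, ‖m' x‖ ≤ K)
    (hK : ∀ᶠ τ in nhdsWithin t s, ∀ x, ‖m τ x - m t x‖ ≤ K * |τ - t|)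
    (hd : ∀ x, HasDerivWithinAt (fun τ => m τ x) (m' x) s t) :
    HasDerivWithinAt (fun τ => mulL2 (m τ) g) (mulL2 m' g) s t := by
  rw [hasDerivWithinAt_iff_tendsto_slope]
  -- The difference quotient is itself a multiplier, bounded by `K` off `τ = t` and converging
  -- pointwise to `m'`.
  have hlim := tendsto_mulL2 (l := nhdsWithin t (s \ {t}))
    (m := fun τ x => ((τ - t)⁻¹ : ℝ) • (m τ x - m t x)) (m₀ := m') (K := K) g
    (fun τ => ((hm τ).sub (hm t)).const_smul ((τ - t)⁻¹)) hm' ?_ hK' ?_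
  · refine hlim.congr' ?_
    filter_upwards [self_mem_nhdsWithin] with τ hτ
    obtain ⟨B, hB⟩ := hb τ hτ.1
    obtain ⟨B', hB'⟩ := hb t ht
    have h1 := memLp_mul_of_bound (hm τ) hB g
    have h2 := memLp_mul_of_bound (hm t) hB' g
    have h3 : MemLp (fun x => ((τ - t)⁻¹ : ℝ) • (m τ x - m t x) * g x) 2 volume := by
      refine ((h1.sub h2).const_smul ((τ - t)⁻¹ : ℝ)).ae_eq (.of_forall fun x => ?_)
      simp only [Pi.smul_apply, Pi.sub_apply]
      rw [smul_mul_assoc, sub_mul]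
    rw [slope_def_module]
    refine Lp.ext ?_
    filter_upwards [coeFn_mulL2 h1, coeFn_mulL2 h2, coeFn_mulL2 h3,
      Lp.coeFn_smul ((τ - t)⁻¹ : ℝ) (mulL2 (m τ) g - mulL2 (m t) g),
      Lp.coeFn_sub (mulL2 (m τ) g) (mulL2 (m t) g)] with x e1 e2 e3 e4 e5
    rw [e3, e4, Pi.smul_apply, e5, Pi.sub_apply, e1, e2, smul_mul_assoc, sub_mul]
  · have hK2 := nhdsWithin_mono t (sdiff_subset (s := s) (t := {t})) hK
    filter_upwards [hK2, self_mem_nhdsWithin] with τ h1 hτ x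
    have hne : 0 < |τ - t| := abs_pos.2 (sub_ne_zero.2 hτ.2)
    rw [norm_smul, Real.norm_eq_abs, abs_inv, inv_mul_le_iff₀ hne, mul_comm]
    exact h1 x
  · intro x
    have h := (hasDerivWithinAt_iff_tendsto_slope.1 (hd x))
    exact h.congr fun τ => slope_def_module _ _ _

end DampedWave

/-! ### Distributional derivatives on the Fourier side -/

namespace DampedWave

variable {n : ℕ}

theorem toTemperedDistribution_injective :
    Function.Injective (Lp.toTemperedDistribution : L2 n → 𝓢'(Rn n, ℂ)) := by
  have h := LinearMap.ker_eq_bot.1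
    (Lp.ker_toTemperedDistributionCLM_eq_bot (E := Rn n) (F := ℂ) (μ := volume) (p := 2))
  exact h

/-- A locally integrable function that is paired to zero with all Schwartz functions of compact
support vanishes. -/
theorem ae_eq_of_integral_schwartz {f g : Rn n → ℂ} (hf : LocallyIntegrable f)
    (hg : LocallyIntegrable g) (h : ∀ φ : 𝓢(Rn n, ℂ), HasCompactSupport φ →
      ∫ x, φ x • f x = ∫ x, φ x • g x) : f =ᵐ[volume] g := by
  refine ae_eq_of_integral_contDiff_smul_eq hf hg fun φ hφ hc => ?_
  have hg₁ : HasCompactSupport (Complex.ofRealCLM ∘ φ) := hc.comp_left rfl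
  have hg₂ : ContDiff ℝ (↑(⊤ : ℕ∞)) (Complex.ofRealCLM ∘ φ) := by fun_prop
  simpa using h (hg₁.toSchwartzMap hg₂) hg₁

/-- Both sides are distributions of locally integrable functions, so they agree exactly when the
functions agree almost everywhere. Every differential identity is reduced to this form. -/
theorem smulLeftCLM_eq_iff {m : Rn n → ℂ} (hm : m.HasTemperateGrowth) (F H : L2 n) :
    TemperedDistribution.smulLeftCLM ℂ m (F : 𝓢'(Rn n, ℂ)) = (H : 𝓢'(Rn n, ℂ)) ↔
      H =ᵐ[volume] fun x => m x * F x := by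
  have key : ∀ φ : 𝓢(Rn n, ℂ), TemperedDistribution.smulLeftCLM ℂ m (F : 𝓢'(Rn n, ℂ)) φ
      = ∫ x, φ x • (m x * F x) := by
    intro φ
    simp only [TemperedDistribution.smulLeftCLM_apply_apply, Lp.toTemperedDistribution_apply]
    refine integral_congr_ae (.of_forall fun x => ?_)
    simp only [SchwartzMap.smulLeftCLM_apply_apply hm, smul_eq_mul]
    ring
  constructor
  · intro h
    have hF : LocallyIntegrable F := (Lp.memLp F).locallyIntegrable (by norm_num)
    refine ae_eq_of_integral_schwartz ((Lp.memLp H).locallyIntegrable (by norm_num)) ?_ ?_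
    · have h2 := (locallyIntegrableOn_univ.2 hF).continuousOn_smul
        isOpen_univ.isLocallyClosed hm.1.continuous.continuousOn
      exact locallyIntegrableOn_univ.1 h2
    · intro φ _
      rw [← key, h, Lp.toTemperedDistribution_apply]
  · intro h
    ext φ
    rw [key, Lp.toTemperedDistribution_apply]
    refine integral_congr_ae ?_
    filter_upwards [h] with x hx
    rw [hx]

theorem lineDeriv_eq_iff (v : Rn n) (f g : L2 n) :
    ∂_{v} (f : 𝓢'(Rn n, ℂ)) = (g : 𝓢'(Rn n, ℂ)) ↔
      (𝓕 g : L2 n) =ᵐ[volume]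
        fun ξ => (2 * Real.pi * Complex.I * (inner ℝ ξ v : ℝ)) * (𝓕 f : L2 n) ξ := by
  have hm : (fun ξ : Rn n => ((inner ℝ ξ v : ℝ) : ℂ)).HasTemperateGrowth := by fun_prop
  have hm2 : (fun ξ : Rn n => (2 * Real.pi * Complex.I * (inner ℝ ξ v : ℝ))).HasTemperateGrowth := by
    fun_prop
  rw [← smulLeftCLM_eq_iff hm2, ← Lp.fourier_toTemperedDistribution_eq,
    ← Lp.fourier_toTemperedDistribution_eq]
  have h1 : TemperedDistribution.smulLeftCLM ℂ
      (fun ξ : Rn n => (2 * Real.pi * Complex.I * (inner ℝ ξ v : ℝ))) (𝓕 (f : 𝓢'(Rn n, ℂ)))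
      = 𝓕 (∂_{v} (f : 𝓢'(Rn n, ℂ))) := by
    rw [TemperedDistribution.fourier_lineDerivOp_eq]
    have := TemperedDistribution.smulLeftCLM_smul (F := ℂ) hm (2 * Real.pi * Complex.I)
    exact congrArg (fun L => L (𝓕 (f : 𝓢'(Rn n, ℂ)))) this
  rw [h1]
  constructor
  · intro h; rw [h]
  · intro h
    have := congrArg (fun x : 𝓢'(Rn n, ℂ) => 𝓕⁻ x) h
    simpa using this

/-- The Fourier transform is injective on tempered distributions and turns `Δ` into multiplication
by `-|ζ|²`. Existence uses the implication from right to left, uniqueness the converse. -/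
theorem laplacian_eq_iff (f g : L2 n) :
    Δ (f : 𝓢'(Rn n, ℂ)) = (g : 𝓢'(Rn n, ℂ)) ↔
      (𝓕 g : L2 n) =ᵐ[volume] fun ξ => (-(2 * Real.pi * ‖ξ‖ : ℝ) ^ 2 : ℂ) * (𝓕 f : L2 n) ξ := by
  have hm : (fun ξ : Rn n => Complex.ofReal (‖ξ‖ ^ 2)).HasTemperateGrowth := by fun_prop
  have hm2 : (fun ξ : Rn n => (-(2 * Real.pi * ‖ξ‖ : ℝ) ^ 2 : ℂ))
      = (-(2 * Real.pi) ^ 2 : ℂ) • (fun ξ : Rn n => Complex.ofReal (‖ξ‖ ^ 2)) := by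
    ext ξ
    simp
    ring
  have hm3 : ((-(2 * Real.pi) ^ 2 : ℂ) • (fun ξ : Rn n => Complex.ofReal (‖ξ‖ ^ 2))).HasTemperateGrowth := by
    have : (fun ξ : Rn n => (-(2 * Real.pi) ^ 2 : ℂ) * Complex.ofReal (‖ξ‖ ^ 2)).HasTemperateGrowth := by
      fun_prop
    exact this
  have h0 := smulLeftCLM_eq_iff hm3 (𝓕 f) (𝓕 g)
  rw [← hm2] at h0
  rw [← h0, ← Lp.fourier_toTemperedDistribution_eq, ← Lp.fourier_toTemperedDistribution_eq]
  have h1 : TemperedDistribution.smulLeftCLM ℂ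
      (fun ξ : Rn n => (-(2 * Real.pi * ‖ξ‖ : ℝ) ^ 2 : ℂ)) (𝓕 (f : 𝓢'(Rn n, ℂ)))
      = 𝓕 (Δ (f : 𝓢'(Rn n, ℂ))) := by
    rw [hm2, TemperedDistribution.smulLeftCLM_smul hm,
      TemperedDistribution.laplacian_eq_fourierMultiplierCLM,
      TemperedDistribution.fourierMultiplierCLM_apply,
      ← Complex.coe_smul (-(2 * Real.pi) ^ 2)]
    rw [FourierTransform.fourier_smul]
    simp
  rw [h1]
  constructor
  · intro h; rw [h]
  · intro h
    have := congrArg (fun x : 𝓢'(Rn n, ℂ) => 𝓕⁻ x) h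
    simpa using this

theorem weakPartial_eq (i : Fin n) {f g : L2 n}
    (h : ∂_{EuclideanSpace.single i (1 : ℝ)} (f : 𝓢'(Rn n, ℂ)) = (g : 𝓢'(Rn n, ℂ))) :
    weakPartial i f = g := by
  have hex : ∃ g : L2 n,
      ∂_{EuclideanSpace.single i (1 : ℝ)} (f : 𝓢'(Rn n, ℂ)) = (g : 𝓢'(Rn n, ℂ)) := ⟨g, h⟩
  rw [weakPartial, dif_pos hex]
  exact toTemperedDistribution_injective (hex.choose_spec.symm.trans h)

theorem memSobolev_of_memLp {s : ℝ} {f : L2 n}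
    (h : MemLp (fun ξ => (((1 + ‖ξ‖ ^ 2) ^ (s / 2) : ℝ) : ℂ) * (𝓕 f : L2 n) ξ) 2 volume) :
    TemperedDistribution.MemSobolev s 2 (f : 𝓢'(Rn n, ℂ)) := by
  rw [TemperedDistribution.memSobolev_iff_exists_smulLeftCLM_fourier]
  refine ⟨h.toLp, ?_⟩
  rw [Lp.fourier_toTemperedDistribution_eq, smulLeftCLM_eq_iff (by fun_prop)]
  exact h.coeFn_toLp

/-- On `L¹ ∩ L²` the Fourier transform of `L²` is given by the Fourier integral. -/
theorem fourier_ae_eq {f : L2 n} (hf : Integrable f) :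
    (𝓕 f : L2 n) =ᵐ[volume] 𝓕 (f : Rn n → ℂ) := by
  have hc : Continuous (𝓕 (f : Rn n → ℂ)) :=
    VectorFourier.fourierIntegral_continuous Real.continuous_fourierChar
      continuous_inner hf
  refine ae_eq_of_integral_schwartz ((Lp.memLp _).locallyIntegrable (by norm_num))
    hc.locallyIntegrable fun φ _ => ?_
  rw [← Lp.toTemperedDistribution_apply, ← Lp.fourier_toTemperedDistribution_eq,
    TemperedDistribution.fourier_apply, Lp.toTemperedDistribution_apply]
  -- The distributional transform is defined by duality; moving the Fourier integral from `φ` to `f`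
  -- is Fubini's theorem.
  have h := VectorFourier.integral_fourierIntegral_smul_eq_flip (𝕜 := ℝ) (μ := volume)
    (ν := volume) (L := innerₗ (Rn n)) (e := Real.fourierChar) Real.continuous_fourierChar
    continuous_inner (φ.integrable (μ := volume)) hf
  rw [flip_innerₗ] at h
  exact h

end DampedWave

/-! ### The symbols and multipliers of the problem -/

namespace DampedWave

variable {n : ℕ}

/-- The modulus `|ζ| = 2π|ξ|` of the frequency. -/
noncomputable def freq (ξ : Rn n) : ℝ := 2 * Real.pi * ‖ξ‖

/-- The real-valued symbol of the damping. -/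
noncomputable def damping (θ : ℝ) (ξ : Rn n) : ℝ := Real.log (1 + freq ξ ^ (2 * θ))

theorem freq_nonneg (ξ : Rn n) : 0 ≤ freq ξ := by unfold freq; positivity

theorem continuous_freq : Continuous (freq (n := n)) := by unfold freq; fun_prop

theorem logSymbol_eq (θ : ℝ) (ξ : Rn n) : logSymbol θ ξ = (damping θ ξ : ℂ) := rfl

theorem damping_nonneg (θ : ℝ) (ξ : Rn n) : 0 ≤ damping θ ξ :=
  Real.log_nonneg (le_add_of_nonneg_right (Real.rpow_nonneg (freq_nonneg ξ) _))

theorem continuous_damping {θ : ℝ} (hθ : 0 ≤ θ) : Continuous (damping (n := n) θ) := by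
  unfold damping
  refine Continuous.log ?_ fun ξ => ?_
  · exact continuous_const.add (continuous_freq.rpow_const fun _ => .inr (by positivity))
  · have := Real.rpow_nonneg (freq_nonneg ξ) (2 * θ)
    positivity

/-- Superadditivity of `x ↦ x^{2θ}`, valid for `2θ ≥ 1`, reduces the claim to `log (1 + r) ≤ r`. For
`θ < 1/2` no linear bound holds, as the symbol behaves like `r^{2θ}` near `0`. -/
theorem damping_le {θ : ℝ} (hθ : 1 / 2 < θ) (ξ : Rn n) : damping θ ξ ≤ 2 * θ * freq ξ := by
  have hr := freq_nonneg ξ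
  have h0 := Real.rpow_nonneg hr (2 * θ)
  have h1 : 1 + freq ξ ^ (2 * θ) ≤ (1 + freq ξ) ^ (2 * θ) := by
    have := Real.add_rpow_le_rpow_add (p := 2 * θ) zero_le_one hr (by linarith)
    rwa [Real.one_rpow] at this
  calc damping θ ξ ≤ Real.log ((1 + freq ξ) ^ (2 * θ)) := Real.log_le_log (by positivity) h1
    _ = 2 * θ * Real.log (1 + freq ξ) := Real.log_rpow (by positivity) _
    _ ≤ 2 * θ * freq ξ := by
      have := Real.log_le_sub_one_of_pos (by positivity : 0 < 1 + freq ξ)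
      gcongr
      linarith

/-- The multiplier of the solution operator. -/
noncomputable def dispMult (θ t : ℝ) (ξ : Rn n) : ℂ := (disp (damping θ ξ) (freq ξ) t : ℝ)

/-- The multiplier of the time derivative of the solution operator. -/
noncomputable def velMult (θ t : ℝ) (ξ : Rn n) : ℂ := (vel (damping θ ξ) (freq ξ) t : ℝ)

/-- The multiplier of the time integral of the solution operator. -/
noncomputable def primMult (θ t : ℝ) (ξ : Rn n) : ℂ := (primDisp (damping θ ξ) (freq ξ) t : ℝ)

section Multipliers

variable {θ t : ℝ}

theorem continuous_dispMult (hθ : 0 ≤ θ) (t : ℝ) : Continuous (dispMult (n := n) θ t) :=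
  Complex.continuous_ofReal.comp
    (continuous_disp (continuous_damping hθ) continuous_freq continuous_const)

theorem continuous_velMult (hθ : 0 ≤ θ) (t : ℝ) : Continuous (velMult (n := n) θ t) :=
  Complex.continuous_ofReal.comp
    (continuous_vel (continuous_damping hθ) continuous_freq continuous_const)

theorem continuous_primMult (hθ : 0 ≤ θ) (t : ℝ) : Continuous (primMult (n := n) θ t) :=
  Complex.continuous_ofReal.comp
    (continuous_primDisp (continuous_damping hθ) continuous_freq t)

theorem norm_dispMult_le (ht : 0 ≤ t) (ξ : Rn n) : ‖dispMult θ t ξ‖ ≤ t := by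
  rw [dispMult, Complex.norm_real]
  exact abs_disp_le (damping_nonneg θ ξ) ht

theorem freq_mul_norm_dispMult_le (ht : 0 ≤ t) (ξ : Rn n) : freq ξ * ‖dispMult θ t ξ‖ ≤ 1 := by
  rw [dispMult, Complex.norm_real]
  exact mul_abs_disp_le_one (damping_nonneg θ ξ) (freq_nonneg ξ) ht

theorem norm_velMult_le (ht : 0 ≤ t) (ξ : Rn n) : ‖velMult θ t ξ‖ ≤ 1 := by
  rw [velMult, Complex.norm_real]
  exact abs_vel_le_one (damping_nonneg θ ξ) ht

theorem norm_primMult_le (ht : 0 ≤ t) (ξ : Rn n) : ‖primMult θ t ξ‖ ≤ t * t := by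
  rw [primMult, Complex.norm_real]
  exact abs_primDisp_le (damping_nonneg θ ξ) ht

theorem freq_sq_mul_norm_primMult_le (hθ : 1 / 2 < θ) (ht : 0 ≤ t) (ξ : Rn n) :
    freq ξ ^ 2 * ‖primMult θ t ξ‖ ≤ 2 + 2 * θ := by
  rw [primMult, Complex.norm_real]
  exact sq_mul_abs_primDisp_le (damping_nonneg θ ξ) (freq_nonneg ξ) (damping_le hθ ξ)
    (by linarith) ht

theorem memLp_dispMult (hθ : 0 ≤ θ) (ht : 0 ≤ t) (g : L2 n) :
    MemLp (fun ξ => dispMult θ t ξ * g ξ) 2 volume :=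
  memLp_mul_of_bound (continuous_dispMult hθ t).aestronglyMeasurable (norm_dispMult_le ht) g

theorem memLp_velMult (hθ : 0 ≤ θ) (ht : 0 ≤ t) (g : L2 n) :
    MemLp (fun ξ => velMult θ t ξ * g ξ) 2 volume :=
  memLp_mul_of_bound (continuous_velMult hθ t).aestronglyMeasurable (norm_velMult_le ht) g

theorem memLp_primMult (hθ : 0 ≤ θ) (ht : 0 ≤ t) (g : L2 n) :
    MemLp (fun ξ => primMult θ t ξ * g ξ) 2 volume :=
  memLp_mul_of_bound (continuous_primMult hθ t).aestronglyMeasurable (norm_primMult_le ht) g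

theorem hasDerivWithinAt_mulL2_dispMult (hθ : 0 ≤ θ) (ht : 0 ≤ t) (g : L2 n) :
    HasDerivWithinAt (fun τ => mulL2 (dispMult θ τ) g) (mulL2 (velMult θ t) g) (Ici 0) t := by
  refine hasDerivWithinAt_mulL2 (K := 1) g
    (fun τ => (continuous_dispMult hθ τ).aestronglyMeasurable)
    (fun τ hτ => ⟨τ, norm_dispMult_le hτ⟩) ht
    (continuous_velMult hθ t).aestronglyMeasurable (norm_velMult_le ht) ?_ fun ξ => ?_
  · filter_upwards [self_mem_nhdsWithin] with τ hτ ξ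
    rw [dispMult, dispMult, ← Complex.ofReal_sub, Complex.norm_real, one_mul]
    exact abs_disp_sub_le (damping_nonneg θ ξ) hτ ht
  · exact (hasDerivAt_disp _ _ t).ofReal_comp.hasDerivWithinAt

theorem hasDerivWithinAt_mulL2_primMult (hθ : 0 ≤ θ) (ht : 0 ≤ t) (g : L2 n) :
    HasDerivWithinAt (fun τ => mulL2 (primMult θ τ) g) (mulL2 (dispMult θ t) g) (Ici 0) t := by
  refine hasDerivWithinAt_mulL2 (K := t + 1) g
    (fun τ => (continuous_primMult hθ τ).aestronglyMeasurable)
    (fun τ hτ => ⟨τ * τ, norm_primMult_le hτ⟩) ht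
    (continuous_dispMult hθ t).aestronglyMeasurable
    (fun ξ => (norm_dispMult_le ht ξ).trans (by linarith)) ?_ fun ξ => ?_
  · filter_upwards [self_mem_nhdsWithin,
      mem_nhdsWithin_of_mem_nhds (Iic_mem_nhds (lt_add_one t))] with τ hτ hτ' ξ
    rw [primMult, primMult, ← Complex.ofReal_sub, Complex.norm_real]
    exact abs_primDisp_sub_le (damping_nonneg θ ξ) ⟨hτ, hτ'⟩ ⟨ht, by linarith⟩
  · exact (hasDerivAt_primDisp _ _ t).ofReal_comp.hasDerivWithinAt

theorem continuousOn_mulL2_velMult (hθ : 0 ≤ θ) (g : L2 n) :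
    ContinuousOn (fun τ => mulL2 (velMult θ τ) g) (Ici 0) := by
  intro t ht
  refine tendsto_mulL2 (K := 1) g (fun τ => (continuous_velMult hθ τ).aestronglyMeasurable)
    (continuous_velMult hθ t).aestronglyMeasurable ?_ (norm_velMult_le ht) fun ξ => ?_
  · filter_upwards [self_mem_nhdsWithin] with τ hτ using norm_velMult_le hτ
  · exact (hasDerivAt_vel _ _ t).ofReal_comp.continuousAt.continuousWithinAt

/-- The multiplier of the partial derivatives of the solution operator. -/
noncomputable def gradMult (θ : ℝ) (i : Fin n) (t : ℝ) (ξ : Rn n) : ℂ :=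
  2 * Real.pi * Complex.I * (ξ i : ℝ) * dispMult θ t ξ

theorem continuous_gradMult (hθ : 0 ≤ θ) (i : Fin n) (t : ℝ) : Continuous (gradMult θ i t) := by
  have := continuous_dispMult (n := n) hθ t
  unfold gradMult
  fun_prop

theorem norm_gradMult (i : Fin n) (t : ℝ) (ξ : Rn n) :
    ‖gradMult θ i t ξ‖ = 2 * Real.pi * |ξ i| * ‖dispMult θ t ξ‖ := by
  simp [gradMult, abs_of_pos Real.pi_pos]

theorem norm_gradMult_le (ht : 0 ≤ t) (i : Fin n) (ξ : Rn n) : ‖gradMult θ i t ξ‖ ≤ 1 := by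
  rw [norm_gradMult]
  refine le_trans ?_ (freq_mul_norm_dispMult_le (θ := θ) ht ξ)
  unfold freq
  gcongr
  exact PiLp.norm_apply_le ξ i

theorem memLp_gradMult (hθ : 0 ≤ θ) (ht : 0 ≤ t) (i : Fin n) (g : L2 n) :
    MemLp (fun ξ => gradMult θ i t ξ * g ξ) 2 volume :=
  memLp_mul_of_bound (continuous_gradMult hθ i t).aestronglyMeasurable (norm_gradMult_le ht i) g

theorem continuousOn_mulL2_gradMult (hθ : 0 ≤ θ) (i : Fin n) (g : L2 n) :
    ContinuousOn (fun τ => mulL2 (gradMult θ i τ) g) (Ici 0) := by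
  intro t ht
  refine tendsto_mulL2 (K := 1) g (fun τ => (continuous_gradMult hθ i τ).aestronglyMeasurable)
    (continuous_gradMult hθ i t).aestronglyMeasurable ?_ (norm_gradMult_le ht i) fun ξ => ?_
  · filter_upwards [self_mem_nhdsWithin] with τ hτ using norm_gradMult_le hτ i
  · exact ((hasDerivAt_disp _ _ t).ofReal_comp.continuousAt.const_mul _).continuousWithinAt

end Multipliers

/-! ### Existence of a mild solution -/

/-- The inverse Fourier transform of `L²` as a real-linear continuous map. -/
noncomputable def fourierInvRealCLM (n : ℕ) : L2 n →L[ℝ] L2 n :=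
  (FourierTransform.fourierInvCLM ℂ (L2 n)).restrictScalars ℝ

theorem fourierInvRealCLM_apply (f : L2 n) : fourierInvRealCLM n f = 𝓕⁻ f := rfl

/-- The Fourier transform of `L²` as a real-linear continuous map. -/
noncomputable def fourierRealCLM (n : ℕ) : L2 n →L[ℝ] L2 n :=
  (FourierTransform.fourierCLM ℂ (L2 n)).restrictScalars ℝ

theorem fourierRealCLM_apply (f : L2 n) : fourierRealCLM n f = 𝓕 f := rfl

theorem fourier_injective {f g : L2 n} (h : (𝓕 f : L2 n) = 𝓕 g) : f = g := by
  have := congrArg (fun x : L2 n => 𝓕⁻ x) h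
  simpa using this

theorem fourier_sub (f g : L2 n) : (𝓕 (f - g) : L2 n) = 𝓕 f - 𝓕 g :=
  (fourierRealCLM n).map_sub f g

theorem norm_fourierInv (f : L2 n) : ‖(𝓕⁻ f : L2 n)‖ = ‖f‖ := by
  rw [← Lp.norm_fourier_eq, FourierTransform.fourier_fourierInv_eq]

/-- The solution of the Cauchy problem with data `(0, u₁)`. -/
noncomputable def solution (θ : ℝ) (u₁ : L2 n) (t : ℝ) : L2 n := 𝓕⁻ (mulL2 (dispMult θ t) (𝓕 u₁))

section Solution

variable {θ t : ℝ} (u₁ : L2 n)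

theorem hasDerivWithinAt_solution (hθ : 0 ≤ θ) (ht : 0 ≤ t) :
    HasDerivWithinAt (solution θ u₁) (𝓕⁻ (mulL2 (velMult θ t) (𝓕 u₁)) : L2 n) (Ici 0) t :=
  (fourierInvRealCLM n).hasFDerivAt.comp_hasDerivWithinAt t
    (hasDerivWithinAt_mulL2_dispMult hθ ht (𝓕 u₁))

theorem timeDeriv_solution (hθ : 0 ≤ θ) (ht : 0 ≤ t) :
    timeDeriv (solution θ u₁) t = 𝓕⁻ (mulL2 (velMult θ t) (𝓕 u₁)) :=
  (hasDerivWithinAt_solution u₁ hθ ht).derivWithin (uniqueDiffOn_Ici 0 t ht)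

theorem continuousOn_solution (hθ : 0 ≤ θ) : ContinuousOn (solution θ u₁) (Ici 0) :=
  fun _ ht => (hasDerivWithinAt_solution u₁ hθ ht).continuousWithinAt

/-- The curve on the right has derivative `solution` in `L²`, so the fundamental theorem of calculus
replaces an exchange of the time integral with the multiplier. -/
theorem integral_solution (hθ : 0 ≤ θ) (ht : 0 ≤ t) :
    ∫ s in (0 : ℝ)..t, solution θ u₁ s = 𝓕⁻ (mulL2 (primMult θ t) (𝓕 u₁)) := by
  have hd : ∀ s, 0 ≤ s → HasDerivWithinAt
      (fun τ => (𝓕⁻ (mulL2 (primMult θ τ) (𝓕 u₁)) : L2 n)) (solution θ u₁ s) (Ici 0) s :=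
    fun s hs => (fourierInvRealCLM n).hasFDerivAt.comp_hasDerivWithinAt s
      (hasDerivWithinAt_mulL2_primMult hθ hs (𝓕 u₁))
  have hsub : uIcc 0 t ⊆ Ici 0 := by rw [uIcc_of_le ht]; exact Icc_subset_Ici_self
  have h := intervalIntegral.integral_eq_sub_of_hasDeriv_right_of_le ht
    (f := fun τ => (𝓕⁻ (mulL2 (primMult θ τ) (𝓕 u₁)) : L2 n))
    (f' := solution θ u₁)
    (fun s hs => ((hd s hs.1).mono Icc_subset_Ici_self).continuousWithinAt)
    (fun s hs => (hd s hs.1.le).mono (Ioi_subset_Ici hs.1.le))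
    (((continuousOn_solution u₁ hθ).mono hsub).intervalIntegrable)
  rw [h]
  have h0 : mulL2 (primMult θ 0) (𝓕 u₁) = 0 := by
    refine Lp.ext ?_
    filter_upwards [coeFn_mulL2 (memLp_primMult hθ le_rfl (𝓕 u₁)),
      Lp.coeFn_zero (E := ℂ) (p := 2) (μ := (volume : Measure (Rn n)))] with x h1 h2
    rw [h1, h2]
    simp [primMult]
  have h1 := (fourierInvRealCLM n).map_zero
  rw [fourierInvRealCLM_apply] at h1
  rw [h0, h1, sub_zero]

theorem lineDeriv_solution (hθ : 0 ≤ θ) (ht : 0 ≤ t) (i : Fin n) :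
    ∂_{EuclideanSpace.single i (1 : ℝ)} (solution θ u₁ t : 𝓢'(Rn n, ℂ)) =
      ((𝓕⁻ (mulL2 (gradMult θ i t) (𝓕 u₁)) : L2 n) : 𝓢'(Rn n, ℂ)) := by
  rw [lineDeriv_eq_iff, solution, FourierTransform.fourier_fourierInv_eq,
    FourierTransform.fourier_fourierInv_eq]
  filter_upwards [coeFn_mulL2 (memLp_gradMult hθ ht i (𝓕 u₁)),
    coeFn_mulL2 (memLp_dispMult hθ ht (𝓕 u₁))] with ξ h1 h2
  rw [h1, h2, gradMult, EuclideanSpace.inner_single_right]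
  simp
  ring

theorem weakPartial_solution (hθ : 0 ≤ θ) (ht : 0 ≤ t) (i : Fin n) :
    weakPartial i (solution θ u₁ t) = 𝓕⁻ (mulL2 (gradMult θ i t) (𝓕 u₁)) :=
  weakPartial_eq i (lineDeriv_solution u₁ hθ ht i)

/-- The weight is at most `1 + |ζ|`; the bounds `|s| ≤ t` and `|ζ| |s| ≤ 1` add up to `t + 1`. -/
theorem memSobolev_solution (hθ : 0 ≤ θ) (ht : 0 ≤ t) :
    TemperedDistribution.MemSobolev 1 2 (solution θ u₁ t : 𝓢'(Rn n, ℂ)) := by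
  refine memSobolev_of_memLp ?_
  rw [solution, FourierTransform.fourier_fourierInv_eq]
  have hg : (fun ξ : Rn n => (((1 + ‖ξ‖ ^ 2) ^ (1 / 2 : ℝ) : ℝ) : ℂ)).HasTemperateGrowth := by
    fun_prop
  have hc := hg.1.continuous
  refine (memLp_mul_of_bound (m := fun ξ => (((1 + ‖ξ‖ ^ 2) ^ (1 / 2 : ℝ) : ℝ) : ℂ)
    * dispMult θ t ξ) (K := t + 1)
    (hc.mul (continuous_dispMult hθ t)).aestronglyMeasurable (fun ξ => ?_) (𝓕 u₁)).ae_eq ?_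
  · rw [norm_mul, Complex.norm_real, Real.norm_of_nonneg (by positivity)]
    have h1 : (1 + ‖ξ‖ ^ 2) ^ (1 / 2 : ℝ) ≤ 1 + freq ξ := by
      rw [← Real.sqrt_eq_rpow]
      refine Real.sqrt_le_iff.2 ⟨by linarith [freq_nonneg ξ], ?_⟩
      have h2 : ‖ξ‖ ≤ freq ξ := by
        unfold freq
        nlinarith [Real.pi_gt_three, norm_nonneg ξ]
      nlinarith [norm_nonneg ξ]
    calc _ ≤ (1 + freq ξ) * ‖dispMult θ t ξ‖ := by gcongr
      _ ≤ t + 1 := by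
        linarith [norm_dispMult_le (θ := θ) ht ξ, freq_mul_norm_dispMult_le (θ := θ) ht ξ]
  · filter_upwards [coeFn_mulL2 (memLp_dispMult hθ ht (𝓕 u₁))] with ξ h
    rw [h, mul_assoc]

/-- The multiplier `s` compensates only one power of `|ζ|`; its time integral compensates two, with
a bound that needs `b ≤ 2θ |ζ|`. -/
theorem memSobolev_integral_solution (hθ : 1 / 2 < θ) (ht : 0 ≤ t) :
    TemperedDistribution.MemSobolev 2 2
      ((∫ s in (0 : ℝ)..t, solution θ u₁ s : L2 n) : 𝓢'(Rn n, ℂ)) := by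
  have hθ' : 0 ≤ θ := by linarith
  refine memSobolev_of_memLp ?_
  rw [integral_solution u₁ hθ' ht, FourierTransform.fourier_fourierInv_eq]
  have hg : (fun ξ : Rn n => (((1 + ‖ξ‖ ^ 2) ^ (2 / 2 : ℝ) : ℝ) : ℂ)).HasTemperateGrowth := by
    fun_prop
  have hc := hg.1.continuous
  refine (memLp_mul_of_bound (m := fun ξ => (((1 + ‖ξ‖ ^ 2) ^ (2 / 2 : ℝ) : ℝ) : ℂ)
    * primMult θ t ξ) (K := t * t + (2 + 2 * θ))
    (hc.mul (continuous_primMult hθ' t)).aestronglyMeasurable (fun ξ => ?_) (𝓕 u₁)).ae_eq ?_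
  · rw [norm_mul, Complex.norm_real, Real.norm_of_nonneg (by positivity)]
    have h1 : (1 + ‖ξ‖ ^ 2) ^ (2 / 2 : ℝ) ≤ 1 + freq ξ ^ 2 := by
      rw [div_self two_ne_zero, Real.rpow_one]
      have h2 : ‖ξ‖ ≤ freq ξ := by
        unfold freq
        nlinarith [Real.pi_gt_three, norm_nonneg ξ]
      gcongr
    calc _ ≤ (1 + freq ξ ^ 2) * ‖primMult θ t ξ‖ := by gcongr
      _ ≤ _ := by
        linarith [norm_primMult_le (θ := θ) ht ξ, freq_sq_mul_norm_primMult_le hθ ht ξ]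
  · filter_upwards [coeFn_mulL2 (memLp_primMult hθ' ht (𝓕 u₁))] with ξ h
    rw [h, mul_assoc]

theorem memLogDomain_solution (hθ : 1 / 2 < θ) (ht : 0 ≤ t) :
    MemLogDomain θ (solution θ u₁ t) := by
  have hθ' : 0 ≤ θ := by linarith
  unfold MemLogDomain
  rw [solution, FourierTransform.fourier_fourierInv_eq]
  refine (memLp_mul_of_bound (m := fun ξ => (damping θ ξ : ℂ) * dispMult θ t ξ) (K := 2 * θ)
    ((Complex.continuous_ofReal.comp (continuous_damping hθ')).mul
      (continuous_dispMult hθ' t)).aestronglyMeasurable (fun ξ => ?_) (𝓕 u₁)).ae_eq ?_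
  · rw [norm_mul, Complex.norm_real, Real.norm_of_nonneg (damping_nonneg θ ξ)]
    calc _ ≤ 2 * θ * freq ξ * ‖dispMult θ t ξ‖ := by gcongr; exact damping_le hθ ξ
      _ = 2 * θ * (freq ξ * ‖dispMult θ t ξ‖) := by ring
      _ ≤ 2 * θ * 1 := by gcongr; exact freq_mul_norm_dispMult_le ht ξ
      _ = _ := mul_one _
  · filter_upwards [coeFn_mulL2 (memLp_dispMult hθ' ht (𝓕 u₁))] with ξ h
    rw [h, mul_assoc, logSymbol_eq]

theorem laplacian_integral_solution (hθ : 1 / 2 < θ) (ht : 0 ≤ t) :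
    Δ ((∫ s in (0 : ℝ)..t, solution θ u₁ s : L2 n) : 𝓢'(Rn n, ℂ)) =
      ((timeDeriv (solution θ u₁) t
        + logDamping θ (solution θ u₁ t) (memLogDomain_solution u₁ hθ ht) - u₁ : L2 n) :
        𝓢'(Rn n, ℂ)) := by
  have hθ' : 0 ≤ θ := by linarith
  rw [laplacian_eq_iff, integral_solution u₁ hθ' ht, timeDeriv_solution u₁ hθ' ht, logDamping,
    FourierTransform.fourier_fourierInv_eq, fourier_sub,
    FourierTransform.fourier_add, FourierTransform.fourier_fourierInv_eq,
    FourierTransform.fourier_fourierInv_eq]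
  have h0 := (memLogDomain_solution u₁ hθ ht).coeFn_toLp
  have h6 : (𝓕 (solution θ u₁ t) : L2 n) = mulL2 (dispMult θ t) (𝓕 u₁) :=
    FourierTransform.fourier_fourierInv_eq _
  set H := (memLogDomain_solution u₁ hθ ht).toLp
  filter_upwards [h0,
    coeFn_mulL2 (memLp_primMult hθ' ht (𝓕 u₁)), coeFn_mulL2 (memLp_velMult hθ' ht (𝓕 u₁)),
    coeFn_mulL2 (memLp_dispMult hθ' ht (𝓕 u₁)),
    Lp.coeFn_sub (mulL2 (velMult θ t) (𝓕 u₁) + H) (𝓕 u₁),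
    Lp.coeFn_add (mulL2 (velMult θ t) (𝓕 u₁)) H] with ξ h1 h2 h3 h4 h5 h7
  rw [h5, Pi.sub_apply, h7, Pi.add_apply, h1, h2, h3, h6, h4, logSymbol_eq]
  have hJ := sq_mul_primDisp (damping θ ξ) (freq ξ) t
  have hJ' : ((freq ξ : ℝ) : ℂ) ^ 2 * primMult θ t ξ
      = 1 - velMult θ t ξ - (damping θ ξ : ℂ) * dispMult θ t ξ := by
    simp only [primMult, velMult, dispMult]
    exact_mod_cast congrArg (fun x : ℝ => (x : ℂ)) hJ
  have hf : 2 * Real.pi * ‖ξ‖ = freq ξ := rfl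
  rw [hf]
  -- At each frequency the mild equation is `sq_mul_primDisp` multiplied by `û₁`.
  linear_combination (𝓕 u₁ : L2 n) ξ * hJ'

theorem isMildSolution_solution (hθ : 1 / 2 < θ) : IsMildSolution θ u₁ (solution θ u₁) := by
  have hθ' : 0 ≤ θ := by linarith
  refine ⟨?_, fun t ht => memSobolev_solution u₁ hθ' ht, fun i => ?_, ?_, ?_,
    fun t ht => memSobolev_integral_solution u₁ hθ ht,
    fun t ht => ⟨memLogDomain_solution u₁ hθ ht, ?_⟩⟩
  · rw [contDiffOn_one_iff_derivWithin (uniqueDiffOn_Ici 0)]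
    refine ⟨fun t ht => (hasDerivWithinAt_solution u₁ hθ' ht).differentiableWithinAt, ?_⟩
    refine ((fourierInvRealCLM n).continuous.comp_continuousOn
      (continuousOn_mulL2_velMult hθ' (𝓕 u₁))).congr fun t ht => ?_
    exact timeDeriv_solution u₁ hθ' ht
  · refine ((fourierInvRealCLM n).continuous.comp_continuousOn
      (continuousOn_mulL2_gradMult hθ' i (𝓕 u₁))).congr fun t ht => ?_
    exact weakPartial_solution u₁ hθ' ht i
  · refine fourier_injective ?_
    rw [solution, FourierTransform.fourier_fourierInv_eq, FourierTransform.fourier_zero]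
    refine Lp.ext ?_
    filter_upwards [coeFn_mulL2 (memLp_dispMult hθ' le_rfl (𝓕 u₁)),
      Lp.coeFn_zero (E := ℂ) (p := 2) (μ := (volume : Measure (Rn n)))] with x h1 h2
    rw [h1, h2]
    simp [dispMult]
  · refine fourier_injective ?_
    rw [timeDeriv_solution u₁ hθ' le_rfl, FourierTransform.fourier_fourierInv_eq]
    refine Lp.ext ?_
    filter_upwards [coeFn_mulL2 (memLp_velMult hθ' le_rfl (𝓕 u₁))] with x h1
    rw [h1]
    simp [velMult]
  · rw [laplacian_integral_solution u₁ hθ ht]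
    simp only [← Lp.toTemperedDistributionCLM_apply, map_sub, map_add]
    abel

end Solution

end DampedWave

/-! ### Uniqueness -/

namespace DampedWave

variable {n : ℕ}

/-- Multiplication by a bounded function as a continuous linear map on `L²`. -/
noncomputable def mulCLM (m : Rn n → ℂ) {K : ℝ} (hm : AEStronglyMeasurable m volume)
    (hK : ∀ x, ‖m x‖ ≤ K) : L2 n →L[ℝ] L2 n :=
  LinearMap.mkContinuous
    { toFun := mulL2 m
      map_add' := fun f g => by
        refine Lp.ext ?_
        filter_upwards [coeFn_mulL2 (memLp_mul_of_bound hm hK (f + g)),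
          coeFn_mulL2 (memLp_mul_of_bound hm hK f), coeFn_mulL2 (memLp_mul_of_bound hm hK g),
          Lp.coeFn_add f g, Lp.coeFn_add (mulL2 m f) (mulL2 m g)] with x h1 h2 h3 h4 h5
        rw [h1, h5, h4, Pi.add_apply, Pi.add_apply, h2, h3, mul_add]
      map_smul' := fun c f => by
        refine Lp.ext ?_
        filter_upwards [coeFn_mulL2 (memLp_mul_of_bound hm hK (c • f)),
          coeFn_mulL2 (memLp_mul_of_bound hm hK f),
          Lp.coeFn_smul c f, Lp.coeFn_smul c (mulL2 m f)] with x h1 h2 h3 h4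
        rw [h1, RingHom.id_apply, h4, h3, Pi.smul_apply, Pi.smul_apply, h2, mul_smul_comm] }
    (max K 0) fun f => by
      refine Lp.norm_le_mul_norm_of_ae_le_mul ?_
      filter_upwards [coeFn_mulL2 (memLp_mul_of_bound hm hK f)] with x h1
      change ‖(mulL2 m f) x‖ ≤ _
      rw [h1, norm_mul]
      gcongr
      exact (hK x).trans (le_max_left _ _)

theorem coeFn_mulCLM {m : Rn n → ℂ} {K : ℝ} (hm : AEStronglyMeasurable m volume)
    (hK : ∀ x, ‖m x‖ ≤ K) (f : L2 n) : mulCLM m hm hK f =ᵐ[volume] fun x => m x * f x :=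
  coeFn_mulL2 (memLp_mul_of_bound hm hK f)

/-- The indicator function of a ball, as a multiplier. -/
noncomputable def cutoff (R : ℝ) : Rn n → ℂ := (Metric.closedBall 0 R).indicator 1

theorem norm_cutoff_mul_le {c : Rn n → ℂ} {R K : ℝ} (hK0 : 0 ≤ K)
    (hK : ∀ x ∈ Metric.closedBall (0 : Rn n) R, ‖c x‖ ≤ K) (x : Rn n) :
    ‖cutoff R x * c x‖ ≤ K := by
  by_cases hx : x ∈ Metric.closedBall (0 : Rn n) R
  · simpa [cutoff, hx] using hK x hx
  · simpa [cutoff, hx] using hK0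

theorem aestronglyMeasurable_cutoff (R : ℝ) :
    AEStronglyMeasurable (cutoff (n := n) R) volume :=
  (stronglyMeasurable_const.indicator
    Metric.isClosed_closedBall.measurableSet).aestronglyMeasurable

theorem norm_cutoff_le (R : ℝ) (x : Rn n) : ‖cutoff R x‖ ≤ 1 := by
  simpa using norm_cutoff_mul_le (c := 1) zero_le_one (fun _ _ => by simp) x

theorem cutoff_mul_self (R : ℝ) (x : Rn n) : cutoff R x * cutoff R x = cutoff R x := by
  by_cases hx : x ∈ Metric.closedBall (0 : Rn n) R <;> simp [cutoff, hx]

/-- The restriction of an `L²` function to a ball. -/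
noncomputable def cutoffCLM (n : ℕ) (R : ℝ) : L2 n →L[ℝ] L2 n :=
  mulCLM (cutoff R) (aestronglyMeasurable_cutoff R) (norm_cutoff_le R)

theorem eq_zero_of_cutoffCLM_eq_zero {f : L2 n} (h : ∀ R : ℕ, cutoffCLM n R f = 0) : f = 0 := by
  refine Lp.ext ?_
  have h1 : ∀ᵐ x : Rn n, ∀ R : ℕ, cutoff R x * f x = 0 := by
    refine ae_all_iff.2 fun R => ?_
    filter_upwards [coeFn_mulCLM (aestronglyMeasurable_cutoff (n := n) R) (norm_cutoff_le R) f,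
      Lp.coeFn_zero (E := ℂ) (p := 2) (μ := (volume : Measure (Rn n)))] with x h2 h3
    rw [← h2]
    have h4 := h R
    unfold cutoffCLM at h4
    rw [h4, h3]
    rfl
  filter_upwards [h1, Lp.coeFn_zero (E := ℂ) (p := 2) (μ := (volume : Measure (Rn n)))]
    with x h2 h3
  obtain ⟨R, hR⟩ := exists_nat_ge ‖x‖
  have h4 := h2 R
  have hx : x ∈ Metric.closedBall (0 : Rn n) R := by simpa using hR
  rw [h3]
  simpa [cutoff, hx] using h4

/-- A curve whose frequency-localized second-order linear evolution starts at zero vanishes. -/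
theorem eq_zero_of_evolution {c₀ c₁ : Rn n → ℂ} (hc₀ : Continuous c₀) (hc₁ : Continuous c₁)
    {p q q' : ℝ → L2 n} (hp : ∀ t, 0 ≤ t → HasDerivWithinAt p (q t) (Ici 0) t)
    (hq : ∀ t, 0 ≤ t → HasDerivWithinAt q (q' t) (Ici 0) t) (hp0 : p 0 = 0) (hq0 : q 0 = 0)
    (heq : ∀ t, 0 ≤ t → q' t =ᵐ[volume] fun x => c₀ x * p t x + c₁ x * q t x)
    {t : ℝ} (ht : 0 ≤ t) : q t = 0 := by
  refine eq_zero_of_cutoffCLM_eq_zero fun R => ?_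
  have hbd : ∀ c : Rn n → ℂ, Continuous c →
      ∃ K, 0 ≤ K ∧ ∀ x ∈ Metric.closedBall (0 : Rn n) R, ‖c x‖ ≤ K := by
    intro c hc
    obtain ⟨K, hK⟩ := (isCompact_closedBall (0 : Rn n) R).exists_bound_of_continuousOn
      hc.continuousOn
    exact ⟨max K 0, le_max_right _ _, fun x hx => (hK x hx).trans (le_max_left _ _)⟩
  obtain ⟨K₀, hK₀, hb₀⟩ := hbd c₀ hc₀
  obtain ⟨K₁, hK₁, hb₁⟩ := hbd c₁ hc₁
  -- The coefficients may be unbounded on `ℝⁿ` but not on the ball, so after the cutoff the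
  -- evolution is driven by bounded operators.
  let A₀ := mulCLM (fun x => cutoff R x * c₀ x)
    ((aestronglyMeasurable_cutoff (n := n) R).mul hc₀.aestronglyMeasurable)
    (norm_cutoff_mul_le hK₀ hb₀)
  let A₁ := mulCLM (fun x => cutoff R x * c₁ x)
    ((aestronglyMeasurable_cutoff (n := n) R).mul hc₁.aestronglyMeasurable)
    (norm_cutoff_mul_le hK₁ hb₁)
  have hA₀ : ∀ f, A₀ f =ᵐ[volume] fun x => cutoff R x * c₀ x * f x := coeFn_mulCLM _ _
  have hA₁ : ∀ f, A₁ f =ᵐ[volume] fun x => cutoff R x * c₁ x * f x := coeFn_mulCLM _ _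
  have hq' : ∀ s, 0 ≤ s → cutoffCLM n R (q' s)
      = A₀ (cutoffCLM n R (p s)) + A₁ (cutoffCLM n R (q s)) := by
    intro s hs
    refine Lp.ext ?_
    have hχ := fun f => coeFn_mulCLM (aestronglyMeasurable_cutoff (n := n) R)
      (norm_cutoff_le R) f
    filter_upwards [heq s hs, hχ (q' s), hχ (p s), hχ (q s),
      hA₀ (cutoffCLM n R (p s)), hA₁ (cutoffCLM n R (q s)),
      Lp.coeFn_add (A₀ (cutoffCLM n R (p s))) (A₁ (cutoffCLM n R (q s)))]
      with x h1 h2 h3 h4 h5 h6 h7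
    rw [h7, Pi.add_apply, h5, h6]
    unfold cutoffCLM
    rw [h2, h3, h4, h1]
    linear_combination (-(c₀ x * p s x) - c₁ x * q s x) * cutoff_mul_self (n := n) R x
  let f : ℝ → L2 n × L2 n := fun s => (cutoffCLM n R (p s), cutoffCLM n R (q s))
  have hf : ∀ s, 0 ≤ s → HasDerivWithinAt f
      (cutoffCLM n R (q s), cutoffCLM n R (q' s)) (Ici 0) s := fun s hs =>
    ((cutoffCLM n R).hasFDerivAt.comp_hasDerivWithinAt s (hp s hs)).prodMk
      ((cutoffCLM n R).hasFDerivAt.comp_hasDerivWithinAt s (hq s hs))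
  -- Grönwall's inequality for the pair `(p, q)` in the maximum norm: the constant `1` covers `p' =
  -- q`, and `‖A₀‖ + ‖A₁‖` covers `q'`.
  have h := eq_zero_of_abs_deriv_le_mul_abs_self_of_eq_zero_right
    (f := f) (f' := fun s => (cutoffCLM n R (q s), cutoffCLM n R (q' s)))
    (K := max 1 (‖A₀‖ + ‖A₁‖)) (a := 0) (b := t)
    (fun s hs => ((hf s hs.1).mono Icc_subset_Ici_self).continuousWithinAt)
    (fun s hs => (hf s hs.1).mono (Ici_subset_Ici.2 hs.1))
    (by simp [f, hp0, hq0]) (fun s hs => by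
      refine norm_prod_le_iff.2 ⟨?_, ?_⟩
      · calc ‖cutoffCLM n R (q s)‖ ≤ ‖f s‖ := norm_snd_le (f s)
          _ = 1 * ‖f s‖ := (one_mul _).symm
          _ ≤ _ := by gcongr; exact le_max_left _ _
      · rw [hq' s hs.1]
        calc ‖A₀ (cutoffCLM n R (p s)) + A₁ (cutoffCLM n R (q s))‖
            ≤ ‖A₀‖ * ‖f s‖ + ‖A₁‖ * ‖f s‖ := by
              refine (norm_add_le _ _).trans (add_le_add ?_ ?_)
              · exact (A₀.le_opNorm _).trans (by gcongr; exact norm_fst_le (f s))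
              · exact (A₁.le_opNorm _).trans (by gcongr; exact norm_snd_le (f s))
          _ = (‖A₀‖ + ‖A₁‖) * ‖f s‖ := by ring
          _ ≤ _ := by gcongr; exact le_max_right _ _) t ⟨ht, le_rfl⟩
  exact congrArg Prod.snd h

theorem _root_.IsMildSolution.hasDerivWithinAt {θ : ℝ} {u₁ : L2 n} {w : ℝ → L2 n}
    (h : IsMildSolution θ u₁ w) {t : ℝ} (ht : 0 ≤ t) :
    HasDerivWithinAt w (timeDeriv w t) (Ici 0) t :=
  (h.contDiffOn.differentiableOn (by norm_num) t ht).hasDerivWithinAt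

theorem hasDerivWithinAt_integral {w : ℝ → L2 n} (hw : ContinuousOn w (Ici 0)) {t : ℝ}
    (ht : 0 ≤ t) : HasDerivWithinAt (fun t => ∫ s in (0 : ℝ)..t, w s) (w t) (Ici 0) t := by
  -- Extending `w` by the constant `w 0` to negative times makes the two-sided fundamental theorem
  -- available at `t = 0`.
  have hc : Continuous fun s => w (max s 0) :=
    hw.comp_continuous (by fun_prop) fun s => le_max_right s 0
  have h := (intervalIntegral.integral_hasDerivAt_right (hc.intervalIntegrable 0 t)
    (hc.stronglyMeasurableAtFilter _ _) hc.continuousAt).hasDerivWithinAt (s := Ici 0)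
  rw [max_eq_left ht] at h
  refine h.congr_of_mem (fun s hs => ?_) ht
  refine intervalIntegral.integral_congr fun τ hτ => ?_
  rw [uIcc_of_le hs] at hτ
  simp [max_eq_left hτ.1]

theorem _root_.IsMildSolution.unique {θ : ℝ} (hθ : 0 ≤ θ) {u₁ : L2 n} {w v : ℝ → L2 n}
    (hw : IsMildSolution θ u₁ w) (hv : IsMildSolution θ u₁ v) : EqOn w v (Ici 0) := by
  intro t ht
  have hD : ∀ s, 0 ≤ s → HasDerivWithinAt (fun τ => w τ - v τ)
      (timeDeriv w s - timeDeriv v s) (Ici 0) s := fun s hs =>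
    (hw.hasDerivWithinAt hs).sub (hv.hasDerivWithinAt hs)
  have hDc : ContinuousOn (fun τ => w τ - v τ) (Ici 0) := fun s hs => (hD s hs).continuousWithinAt
  -- With `p` the transform of the time integral of the difference and `q = p'`, subtracting the two
  -- mild equations gives `q' = -|ζ|² p - b q` with zero data.
  have key := eq_zero_of_evolution (n := n)
    (c₀ := fun ξ => (-(2 * Real.pi * ‖ξ‖ : ℝ) ^ 2 : ℂ)) (c₁ := fun ξ => -(damping θ ξ : ℂ))
    (by fun_prop) (Complex.continuous_ofReal.comp (continuous_damping hθ)).neg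
    (p := fun t => fourierRealCLM n (∫ s in (0 : ℝ)..t, (w s - v s)))
    (q := fun t => fourierRealCLM n (w t - v t))
    (q' := fun t => fourierRealCLM n (timeDeriv w t - timeDeriv v t))
    (fun s hs => (fourierRealCLM n).hasFDerivAt.comp_hasDerivWithinAt s
      (hasDerivWithinAt_integral hDc hs))
    (fun s hs => (fourierRealCLM n).hasFDerivAt.comp_hasDerivWithinAt s (hD s hs))
    (by simp) (by simp [hw.init, hv.init]) (fun s hs => ?_) ht
  · have h1 : (𝓕 (w t - v t) : L2 n) = 𝓕 (0 : L2 n) := by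
      rw [FourierTransform.fourier_zero]; exact key
    exact sub_eq_zero.1 (fourier_injective h1)
  · obtain ⟨h1, e1⟩ := hw.equation s hs
    obtain ⟨h2, e2⟩ := hv.equation s hs
    have hsub : uIcc 0 s ⊆ Ici 0 := by rw [uIcc_of_le hs]; exact Icc_subset_Ici_self
    have hint : ∫ τ in (0 : ℝ)..s, (w τ - v τ)
        = (∫ τ in (0 : ℝ)..s, w τ) - ∫ τ in (0 : ℝ)..s, v τ :=
      intervalIntegral.integral_sub ((hw.contDiffOn.continuousOn.mono hsub).intervalIntegrable)
        ((hv.contDiffOn.continuousOn.mono hsub).intervalIntegrable)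
    have hΔ : Δ ((∫ τ in (0 : ℝ)..s, (w τ - v τ) : L2 n) : 𝓢'(Rn n, ℂ)) =
        ((timeDeriv w s - timeDeriv v s + (logDamping θ (w s) h1 - logDamping θ (v s) h2) :
          L2 n) : 𝓢'(Rn n, ℂ)) := by
      rw [hint]
      simp only [← Lp.toTemperedDistributionCLM_apply, map_sub, map_add] at e1 e2 ⊢
      rw [← TemperedDistribution.laplacianCLM_apply, map_sub,
        TemperedDistribution.laplacianCLM_apply, TemperedDistribution.laplacianCLM_apply]
      have e3 := e1.trans e2.symm
      rw [← sub_eq_zero] at e3 ⊢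
      rw [← neg_eq_zero, ← e3]
      abel
    rw [laplacian_eq_iff, FourierTransform.fourier_add, fourier_sub (logDamping θ (w s) h1),
      logDamping, logDamping, FourierTransform.fourier_fourierInv_eq,
      FourierTransform.fourier_fourierInv_eq] at hΔ
    simp only [fourierRealCLM_apply]
    filter_upwards [hΔ, h1.coeFn_toLp, h2.coeFn_toLp,
      Lp.coeFn_add (𝓕 (timeDeriv w s - timeDeriv v s) : L2 n)
        (h1.toLp - h2.toLp), Lp.coeFn_sub h1.toLp h2.toLp,
      Lp.coeFn_sub (𝓕 (w s) : L2 n) (𝓕 (v s))] with ξ a1 a2 a3 a4 a5 a6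
    rw [a4, Pi.add_apply, a5, Pi.sub_apply, a2, a3] at a1
    rw [fourier_sub (w s), a6, Pi.sub_apply]
    simp only [logSymbol_eq] at a1
    linear_combination a1

end DampedWave

/-! ### Upper and lower bounds for the energy -/

namespace DampedWave

variable {n : ℕ} {θ t : ℝ}

theorem integrable_norm_sq_mul {m : Rn n → ℂ} {g : L2 n}
    (h : MemLp (fun x => m x * g x) 2 volume) : Integrable fun x => ‖m x‖ ^ 2 * ‖g x‖ ^ 2 := by
  have h1 := (memLp_two_iff_integrable_sq_norm h.1).1 h
  simpa only [norm_mul, mul_pow] using h1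

/-- Plancherel's identity for the gradient of the solution. -/
theorem gradNorm_sq_solution (hθ : 0 ≤ θ) (ht : 0 ≤ t) (u₁ : L2 n) :
    gradNorm (solution θ u₁ t) ^ 2
      = ∑ i : Fin n, ∫ ξ, ‖gradMult θ i t ξ‖ ^ 2 * ‖(𝓕 u₁ : L2 n) ξ‖ ^ 2 := by
  rw [gradNorm, Real.sq_sqrt (by positivity)]
  refine Finset.sum_congr rfl fun i _ => ?_
  rw [weakPartial_solution u₁ hθ ht i, norm_fourierInv, norm_sq_mulL2 (memLp_gradMult hθ ht i _)]

theorem energy_eq (ξ : Rn n) : energy (damping θ ξ) (freq ξ) t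
    = ‖velMult θ t ξ‖ ^ 2 + ∑ i : Fin n, ‖gradMult θ i t ξ‖ ^ 2 := by
  simp_rw [norm_gradMult, velMult, dispMult, Complex.norm_real, mul_pow, Real.norm_eq_abs, sq_abs]
  rw [← Finset.sum_mul, ← Finset.mul_sum]
  have h := EuclideanSpace.norm_sq_eq ξ
  simp only [Real.norm_eq_abs, sq_abs] at h
  rw [← h, energy, freq]
  ring

theorem integrable_energy (hθ : 0 ≤ θ) (ht : 0 ≤ t) (g : L2 n) :
    Integrable fun ξ => energy (damping θ ξ) (freq ξ) t * ‖g ξ‖ ^ 2 := by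
  simp_rw [energy_eq, add_mul, Finset.sum_mul]
  exact (integrable_norm_sq_mul (memLp_velMult hθ ht g)).add
    (integrable_finsetSum _ fun i _ => integrable_norm_sq_mul (memLp_gradMult hθ ht i g))

/-- The energy of the solution as an integral in frequency space. -/
theorem energy_solution (hθ : 0 ≤ θ) (ht : 0 ≤ t) (u₁ : L2 n) :
    ‖timeDeriv (solution θ u₁) t‖ ^ 2 + gradNorm (solution θ u₁ t) ^ 2
      = ∫ ξ, energy (damping θ ξ) (freq ξ) t * ‖(𝓕 u₁ : L2 n) ξ‖ ^ 2 := by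
  rw [timeDeriv_solution u₁ hθ ht, norm_fourierInv, norm_sq_mulL2 (memLp_velMult hθ ht _),
    gradNorm_sq_solution hθ ht]
  simp_rw [energy_eq, add_mul, Finset.sum_mul]
  rw [integral_add (integrable_norm_sq_mul (memLp_velMult hθ ht _))
    (integrable_finsetSum _ fun i _ => integrable_norm_sq_mul (memLp_gradMult hθ ht i _)),
    integral_finsetSum _ fun i _ => integrable_norm_sq_mul (memLp_gradMult hθ ht i _)]

theorem damping_le_rpow (ξ : Rn n) : damping θ ξ ≤ freq ξ ^ (2 * θ) := by
  have h0 := Real.rpow_nonneg (freq_nonneg ξ) (2 * θ)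
  have := Real.log_le_sub_one_of_pos (by positivity : 0 < 1 + freq ξ ^ (2 * θ))
  unfold damping
  linarith

/-- From `log (1 + x) ≥ 2x / (x + 2)`, where the denominator is at most `4` for `x ≤ 1`. -/
theorem half_rpow_le_damping (hθ : 0 ≤ θ) {ξ : Rn n} (h : freq ξ ≤ 1) :
    freq ξ ^ (2 * θ) / 2 ≤ damping θ ξ := by
  have h0 := Real.rpow_nonneg (freq_nonneg ξ) (2 * θ)
  have h1 : freq ξ ^ (2 * θ) ≤ 1 := Real.rpow_le_one (freq_nonneg ξ) h (by positivity)
  refine le_trans ?_ (Real.le_log_one_add_of_nonneg h0)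
  rw [le_div_iff₀ (by positivity)]
  nlinarith

theorem half_le_damping (hθ : 0 ≤ θ) {ξ : Rn n} (h : 1 ≤ freq ξ) : 1 / 2 ≤ damping θ ξ := by
  have h1 : 1 ≤ freq ξ ^ (2 * θ) := Real.one_le_rpow h (by positivity)
  refine le_trans ?_ (Real.le_log_one_add_of_nonneg (by positivity))
  rw [le_div_iff₀ (by positivity)]
  linarith

/-- The squared decay rate is the factor by which the volume of a ball of radius proportional to
`t^{-1/(2θ)}` shrinks. -/
theorem sq_rpow_neg (ht : 0 < t) :
    (t ^ (-(n : ℝ) / (4 * θ))) ^ 2 = (t ^ (-1 / (2 * θ))) ^ n := by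
  rw [← Real.rpow_mul_natCast ht.le, ← Real.rpow_mul_natCast ht.le]
  congr 1
  rcases eq_or_ne θ 0 with h | h
  · simp [h]
  · push_cast
    field_simp
    ring

theorem integrable_exp_neg_freq_rpow (hn : 1 ≤ n) (hθ : 0 < θ) {a : ℝ} (ha : 0 < a) :
    Integrable fun ξ : Rn n => Real.exp (-a * freq ξ ^ (2 * θ)) := by
  have : Nonempty (Fin n) := ⟨⟨0, hn⟩⟩
  have h : Integrable fun ξ : Rn n => Real.exp (-a * ‖ξ‖ ^ (2 * θ)) := by
    rw [integrable_fun_norm_addHaar volume (f := fun y => Real.exp (-a * y ^ (2 * θ)))]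
    have h1 := integrableOn_rpow_mul_exp_neg_mul_rpow
      (s := ((Module.finrank ℝ (Rn n) - 1 : ℕ) : ℝ)) (p := 2 * θ)
      (lt_of_lt_of_le (by norm_num) (Nat.cast_nonneg _)) (by positivity) ha
    simpa only [Real.rpow_natCast, smul_eq_mul] using h1
  have h2 := h.comp_smul (R := 2 * Real.pi) (by positivity)
  simpa only [norm_smul, Real.norm_of_nonneg (by positivity : 0 ≤ 2 * Real.pi), freq] using h2

theorem exp_neg_mul_freq_rpow_eq (hθ : 0 < θ) (ht : 0 < t) (a : ℝ) (ξ : Rn n) :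
    Real.exp (-a * t * freq ξ ^ (2 * θ))
      = Real.exp (-a * freq (t ^ (1 / (2 * θ)) • ξ) ^ (2 * θ)) := by
  have h : freq (t ^ (1 / (2 * θ)) • ξ) = t ^ (1 / (2 * θ)) * freq ξ := by
    rw [freq, freq, norm_smul, Real.norm_of_nonneg (by positivity)]
    ring
  rw [h, Real.mul_rpow (by positivity) (freq_nonneg ξ), ← Real.rpow_mul ht.le,
    one_div_mul_cancel (by positivity), Real.rpow_one, mul_assoc]

theorem integrable_exp_neg_mul_freq_rpow (hn : 1 ≤ n) (hθ : 0 < θ) (ht : 0 < t) {a : ℝ}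
    (ha : 0 < a) : Integrable fun ξ : Rn n => Real.exp (-a * t * freq ξ ^ (2 * θ)) := by
  simp_rw [exp_neg_mul_freq_rpow_eq hθ ht]
  exact (integrable_exp_neg_freq_rpow hn hθ ha).comp_smul (by positivity)

theorem integral_exp_neg_mul_freq_rpow (hθ : 0 < θ) (ht : 0 < t) (a : ℝ) :
    ∫ ξ : Rn n, Real.exp (-a * t * freq ξ ^ (2 * θ))
      = (t ^ (-(n : ℝ) / (4 * θ))) ^ 2 * ∫ ξ : Rn n, Real.exp (-a * freq ξ ^ (2 * θ)) := by
  simp_rw [exp_neg_mul_freq_rpow_eq hθ ht]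
  rw [Measure.integral_comp_smul volume (fun ξ : Rn n => Real.exp (-a * freq ξ ^ (2 * θ))),
    sq_rpow_neg ht, finrank_euclideanSpace_fin, abs_of_nonneg (by positivity), smul_eq_mul,
    neg_div, Real.rpow_neg ht.le, inv_pow]

theorem norm_fourier_ae_le {u₁ : L2 n} (hu : MemWeightedL1 1 u₁) :
    ∀ᵐ ξ, ‖(𝓕 u₁ : L2 n) ξ‖ ≤ weightedL1Norm 1 u₁ := by
  filter_upwards [fourier_ae_eq hu.1] with ξ h
  rw [h]
  refine (VectorFourier.norm_fourierIntegral_le_integral_norm _ _ _ _ _).trans ?_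
  refine integral_mono hu.1.norm hu.2 fun x => ?_
  have : 0 ≤ ‖x‖ ^ (1 : ℝ) * ‖u₁ x‖ := by positivity
  simp only [add_mul, one_mul]
  linarith

theorem weightedL1Norm_nonneg (f : Rn n → ℂ) : 0 ≤ weightedL1Norm 1 f :=
  integral_nonneg fun x => by positivity

/-- Decay of the energy up to an exponentially small remainder from the high frequencies. -/
theorem exists_energy_solution_le (hn : 1 ≤ n) (hθ : 1 / 2 < θ) :
    ∃ a > 0, ∃ K ≥ 0, ∀ u₁ : L2 n, MemWeightedL1 1 u₁ → ∀ t > 0,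
      ‖timeDeriv (solution θ u₁) t‖ ^ 2 + gradNorm (solution θ u₁ t) ^ 2
        ≤ K * weightedL1Norm 1 u₁ ^ 2 * (t ^ (-(n : ℝ) / (4 * θ))) ^ 2
          + 2 * Real.exp (-a * t) * ‖u₁‖ ^ 2 := by
  have hθ0 : 0 < θ := by linarith
  -- The rate of `energy_le_exp` with `M = 2θ`, halved because `b` is only bounded below by
  -- `|ζ|^{2θ} / 2` at low and by `1/2` at high frequencies.
  let a : ℝ := (1 + (2 * θ) ^ 2)⁻¹ / 4 / 2
  have ha : 0 < a := by positivity
  refine ⟨a, ha, 2 * ∫ ξ : Rn n, Real.exp (-a * freq ξ ^ (2 * θ)), by positivity,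
    fun u₁ hu t ht => ?_⟩
  set A := weightedL1Norm 1 u₁
  rw [energy_solution hθ0.le ht.le]
  have hint := (integrable_exp_neg_mul_freq_rpow hn hθ0 ht ha).const_mul (2 * A ^ 2)
  have hint2 := (integrable_norm_sq (𝓕 u₁ : L2 n)).const_mul (2 * Real.exp (-a * t))
  calc ∫ ξ, energy (damping θ ξ) (freq ξ) t * ‖(𝓕 u₁ : L2 n) ξ‖ ^ 2
      ≤ ∫ ξ, (2 * A ^ 2 * Real.exp (-a * t * freq ξ ^ (2 * θ))
          + 2 * Real.exp (-a * t) * ‖(𝓕 u₁ : L2 n) ξ‖ ^ 2) := by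
        refine integral_mono_ae (integrable_energy hθ0.le ht.le _) (hint.add hint2) ?_
        filter_upwards [norm_fourier_ae_le hu] with ξ hξ
        have hE := energy_le_exp (damping_nonneg θ ξ) (freq_nonneg ξ) (damping_le hθ ξ) ht.le
        have hat : 0 ≤ a * t := by positivity
        have heq : -((1 + (2 * θ) ^ 2)⁻¹ / 4) * damping θ ξ * t
            = -(a * t * (2 * damping θ ξ)) := by simp only [a]; ring
        rw [heq] at hE
        -- Low frequencies use the pointwise bound on `û₁`, high frequencies only its square
        -- integrability.
        rcases le_total (freq ξ) 1 with h | h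
        · have h1 := half_rpow_le_damping hθ0.le h
          have h2 : energy (damping θ ξ) (freq ξ) t ≤ 2 * Real.exp (-a * t * freq ξ ^ (2 * θ)) := by
            refine hE.trans ?_
            gcongr
            nlinarith
          calc _ ≤ 2 * Real.exp (-a * t * freq ξ ^ (2 * θ)) * A ^ 2 := by gcongr
            _ ≤ _ := by
              have : 0 ≤ 2 * Real.exp (-a * t) * ‖(𝓕 u₁ : L2 n) ξ‖ ^ 2 := by positivity
              linarith
        · have h1 := half_le_damping hθ0.le h
          have h2 : energy (damping θ ξ) (freq ξ) t ≤ 2 * Real.exp (-a * t) := by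
            refine hE.trans ?_
            gcongr
            nlinarith
          calc _ ≤ 2 * Real.exp (-a * t) * ‖(𝓕 u₁ : L2 n) ξ‖ ^ 2 := by gcongr
            _ ≤ _ := by
              have : 0 ≤ 2 * A ^ 2 * Real.exp (-a * t * freq ξ ^ (2 * θ)) := by positivity
              linarith
    _ = _ := by
      rw [integral_add hint hint2, integral_const_mul, integral_const_mul,
        integral_exp_neg_mul_freq_rpow hθ0 ht, ← norm_sq_eq_integral, Lp.norm_fourier_eq]
      ring

/-- `û₁` is continuous with value `P₁` at the origin. The radius `δ` depends on `u₁`, and through it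
so does `T`. -/
theorem exists_half_norm_integral_le {u₁ : L2 n} (hu : Integrable u₁) :
    ∃ δ > 0, ∀ᵐ ξ : Rn n, ‖ξ‖ ≤ δ → ‖∫ x, u₁ x‖ / 2 ≤ ‖(𝓕 u₁ : L2 n) ξ‖ := by
  have hc : Continuous (𝓕 (u₁ : Rn n → ℂ)) :=
    VectorFourier.fourierIntegral_continuous Real.continuous_fourierChar continuous_inner hu
  have h0 : 𝓕 (u₁ : Rn n → ℂ) 0 = ∫ x, u₁ x := by simp [Real.fourier_eq]
  rcases eq_or_ne (∫ x, u₁ x) 0 with hP | hP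
  · exact ⟨1, one_pos, .of_forall fun ξ _ => by rw [hP]; simp⟩
  · have hP' : ‖∫ x, u₁ x‖ / 2 < ‖𝓕 (u₁ : Rn n → ℂ) 0‖ := by
      rw [h0]; exact half_lt_self (norm_pos_iff.2 hP)
    obtain ⟨δ, hδ, h⟩ := Metric.nhds_basis_closedBall.eventually_iff.1
      (hc.norm.continuousAt.eventually_const_lt hP')
    refine ⟨δ, hδ, ?_⟩
    filter_upwards [fourier_ae_eq hu] with ξ hξ hξδ
    rw [hξ]
    exact (h (by simpa using hξδ)).le

/-- The low frequencies bound the energy from below. -/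
theorem exists_le_energy_solution (n : ℕ) (hθ : 0 < θ) :
    ∃ c > 0, ∀ u₁ : L2 n, Integrable u₁ → ∀ᶠ t in Filter.atTop,
      c * ‖∫ x, u₁ x‖ ^ 2 * (t ^ (-(n : ℝ) / (4 * θ))) ^ 2
        ≤ ‖timeDeriv (solution θ u₁) t‖ ^ 2 + gradNorm (solution θ u₁ t) ^ 2 := by
  have hvol : 0 < volume.real (Metric.ball (0 : Rn n) 1) :=
    ENNReal.toReal_pos (Metric.measure_ball_pos _ _ one_pos).ne' measure_ball_lt_top.ne
  refine ⟨Real.exp (-2) / 4 * (((2 * Real.pi)⁻¹) ^ n * volume.real (Metric.ball (0 : Rn n) 1)),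
    by positivity, fun u₁ hu => ?_⟩
  obtain ⟨δ, hδ, hP⟩ := exists_half_norm_integral_le hu
  have hlim : Filter.Tendsto (fun t : ℝ => (2 * Real.pi)⁻¹ * t ^ (-(1 / (2 * θ)))) Filter.atTop
      (nhds 0) := by
    have := (tendsto_rpow_neg_atTop (y := 1 / (2 * θ)) (by positivity)).const_mul
      ((2 * Real.pi)⁻¹)
    simpa using this
  filter_upwards [hlim.eventually_le_const hδ, Filter.eventually_gt_atTop 0] with t hρδ ht
  rw [energy_solution hθ.le ht.le]
  -- On this ball `|ζ|^{2θ} ≤ 1/t`, hence `b t ≤ 1` and the energy has lost at most the factor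
  -- `e^{-2}`.
  set ρ := (2 * Real.pi)⁻¹ * t ^ (-(1 / (2 * θ))) with hρ
  have hρ0 : 0 ≤ ρ := by positivity
  set P := ‖∫ x, u₁ x‖
  have hint := integrable_energy hθ.le ht.le (𝓕 u₁)
  have hlow : ∀ᵐ ξ : Rn n, ξ ∈ Metric.closedBall (0 : Rn n) ρ →
      Real.exp (-2) * (P / 2) ^ 2
        ≤ energy (damping θ ξ) (freq ξ) t * ‖(𝓕 u₁ : L2 n) ξ‖ ^ 2 := by
    filter_upwards [hP] with ξ h1 hξ
    rw [mem_closedBall_zero_iff] at hξ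
    have h2 := h1 (hξ.trans hρδ)
    have h3 : freq ξ ≤ t ^ (-(1 / (2 * θ))) := by
      calc freq ξ ≤ 2 * Real.pi * ρ := by unfold freq; gcongr
        _ = _ := by rw [hρ]; field_simp
    have h4 : freq ξ ^ (2 * θ) ≤ t⁻¹ := by
      calc freq ξ ^ (2 * θ) ≤ (t ^ (-(1 / (2 * θ)))) ^ (2 * θ) :=
            Real.rpow_le_rpow (freq_nonneg ξ) h3 (by positivity)
        _ = t⁻¹ := by
          rw [← Real.rpow_mul ht.le, neg_mul, one_div_mul_cancel (by positivity),
            Real.rpow_neg_one]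
    have h5 : damping θ ξ * t ≤ 1 := by
      calc _ ≤ t⁻¹ * t := by gcongr; exact (damping_le_rpow ξ).trans h4
        _ = 1 := inv_mul_cancel₀ ht.ne'
    have h6 : Real.exp (-2) ≤ energy (damping θ ξ) (freq ξ) t := by
      refine le_trans (Real.exp_le_exp.2 ?_) (exp_le_energy (damping_nonneg θ ξ) ht.le)
      linarith
    have h7 := energy_nonneg (damping θ ξ) (freq ξ) t
    gcongr
  calc _ = ∫ ξ in Metric.closedBall (0 : Rn n) ρ, Real.exp (-2) * (P / 2) ^ 2 := by
        rw [setIntegral_const, Measure.addHaar_real_closedBall volume _ hρ0,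
          finrank_euclideanSpace_fin, sq_rpow_neg ht, hρ, mul_pow, smul_eq_mul, neg_div]
        ring
    _ ≤ ∫ ξ in Metric.closedBall (0 : Rn n) ρ,
          energy (damping θ ξ) (freq ξ) t * ‖(𝓕 u₁ : L2 n) ξ‖ ^ 2 :=
        setIntegral_mono_on_ae (integrableOn_const measure_closedBall_lt_top.ne)
          hint.integrableOn Metric.isClosed_closedBall.measurableSet hlow
    _ ≤ _ := setIntegral_le_integral hint
        (.of_forall fun ξ => mul_nonneg (energy_nonneg _ _ _) (by positivity))

end DampedWave

/-! ### The two-sided estimate -/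

theorem theorem1p3 (n : ℕ) (hn : 1 ≤ n) (θ : ℝ) (hθ : 1 / 2 < θ) :
    ∃ C : ℝ, 0 < C ∧ ∀ u₁ : L2 n, MemWeightedL1 1 u₁ →
      ∃ u : ℝ → L2 n, IsMildSolution θ u₁ u ∧
        (∀ w : ℝ → L2 n, IsMildSolution θ u₁ w → EqOn w u (Ici 0)) ∧
        ∃ T : ℝ, 0 < T ∧ ∀ t : ℝ, T ≤ t →
          C * ‖∫ x, u₁ x‖ * t ^ (-(n : ℝ) / (4 * θ)) ≤ ‖timeDeriv u t‖ + gradNorm (u t) ∧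
          ‖timeDeriv u t‖ + gradNorm (u t) ≤
            C⁻¹ * (weightedL1Norm 1 u₁ + ‖u₁‖) * t ^ (-(n : ℝ) / (4 * θ)) := by
  have hθ0 : 0 < θ := by linarith
  obtain ⟨a, ha, K, hK, hup⟩ := DampedWave.exists_energy_solution_le hn hθ
  obtain ⟨c, hc, hlow⟩ := DampedWave.exists_le_energy_solution n hθ0
  -- The `2` inside comes from `(x + y)² ≤ 2 (x² + y²)`; in `K + 2`, the `K` is the low-frequency
  -- constant and the `2` pays for the exponential remainder.
  let B : ℝ := Real.sqrt (2 * (K + 2))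
  have hB : 0 < B := Real.sqrt_pos.2 (by positivity)
  refine ⟨min (Real.sqrt c) B⁻¹, lt_min (Real.sqrt_pos.2 hc) (inv_pos.2 hB), fun u₁ hu => ?_⟩
  refine ⟨DampedWave.solution θ u₁, DampedWave.isMildSolution_solution u₁ hθ,
    fun w hw => hw.unique hθ0.le (DampedWave.isMildSolution_solution u₁ hθ), ?_⟩
  -- For large `t` the high-frequency remainder is below the polynomial rate and is absorbed by it.
  have hdecay : ∀ᶠ t : ℝ in Filter.atTop,
      Real.exp (-a * t) ≤ (t ^ (-(n : ℝ) / (4 * θ))) ^ 2 := by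
    filter_upwards [(isLittleO_exp_neg_mul_rpow_atTop ha
      (-(n : ℝ) / (4 * θ) * (2 : ℕ))).bound one_pos, Filter.eventually_gt_atTop 0] with t h ht
    rw [Real.rpow_mul_natCast ht.le] at h
    rwa [one_mul, Real.norm_of_nonneg (by positivity), Real.norm_of_nonneg (by positivity)] at h
  obtain ⟨T, hT⟩ := Filter.eventually_atTop.1
    ((hlow u₁ hu.1).and (hdecay.and (Filter.eventually_gt_atTop 0)))
  refine ⟨max T 1, by positivity, fun t htT => ?_⟩
  obtain ⟨h1, h2, ht⟩ := hT t ((le_max_left _ _).trans htT)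
  have h3 := hup u₁ hu t ht
  have hx : 0 ≤ ‖timeDeriv (DampedWave.solution θ u₁) t‖ := norm_nonneg _
  have hy : 0 ≤ gradNorm (DampedWave.solution θ u₁ t) := Real.sqrt_nonneg _
  have hA := DampedWave.weightedL1Norm_nonneg (u₁ : Rn n → ℂ)
  have hτ : 0 < t ^ (-(n : ℝ) / (4 * θ)) := by positivity
  set x := ‖timeDeriv (DampedWave.solution θ u₁) t‖
  set y := gradNorm (DampedWave.solution θ u₁ t)
  set A := weightedL1Norm 1 (u₁ : Rn n → ℂ)
  set τ := t ^ (-(n : ℝ) / (4 * θ))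
  constructor
  · calc min (Real.sqrt c) B⁻¹ * ‖∫ x, u₁ x‖ * τ ≤ Real.sqrt c * ‖∫ x, u₁ x‖ * τ := by
          gcongr
          exact min_le_left _ _
      _ ≤ x + y := by
        -- Since `x, y ≥ 0`, the square of `x + y` dominates the energy `x² + y²`.
        refine le_of_sq_le_sq ?_ (by positivity)
        rw [mul_pow, mul_pow, Real.sq_sqrt hc.le]
        nlinarith
  · calc x + y ≤ B * (A + ‖u₁‖) * τ := by
          refine le_of_sq_le_sq ?_ (by positivity)
          rw [mul_pow, mul_pow, Real.sq_sqrt (by positivity)]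
          have h4 : x ^ 2 + y ^ 2 ≤ (K + 2) * (A + ‖u₁‖) ^ 2 * τ ^ 2 := by
            calc x ^ 2 + y ^ 2 ≤ K * A ^ 2 * τ ^ 2 + 2 * Real.exp (-a * t) * ‖u₁‖ ^ 2 := h3
              _ ≤ K * (A + ‖u₁‖) ^ 2 * τ ^ 2 + 2 * τ ^ 2 * (A + ‖u₁‖) ^ 2 := by
                have := norm_nonneg u₁
                gcongr <;> linarith
              _ = _ := by ring
          nlinarith [sq_nonneg (x - y)]
      _ ≤ (min (Real.sqrt c) B⁻¹)⁻¹ * (A + ‖u₁‖) * τ := by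
          gcongr
          rw [le_inv_comm₀ hB (lt_min (Real.sqrt_pos.2 hc) (inv_pos.2 hB))]
          exact min_le_right _ _
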